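/- Write $\mathcal M_d$ for the algebra of complex $d\times d$ matrices. For real $p\ge 1$ let $\|A\|_p=(\operatorname{Tr}|A|^p)^{1/p}$, $|A|=(AA^*)^{1/2}$, be the Schatten norm, and for a linear map $L:\mathcal M_d\to\mathcal M_{d'}$ and real $q,p\ge 1$ let $$\|L\|_{q\to p}=\sup_{A\in\mathcal M_d,\ A\ne 0}\frac{\|L(A)\|_p}{\|A\|_q}.$$ $L$ is completely positive (CP) if $\mathrm{id}_n\otimes L$ maps positive semidefinite matrices to positive semidefinite matrices for every $n\ge 1$. For a CP map $\Phi:\mathcal M_d\to\mathcal M_{d'}$ the potential output purity is $$\|\Phi\|_{q\to p}^{(pot)}=\sup_{n\ge 1}\ \sup_{\Omega}\ \frac{\|\Phi\otimes\Omega\|_{q\to p}}{\|\Omega\|_{q\to p}},$$ where the inner supremum runs over all nonzero CP maps $\Omega:\mathcal M_n\to\mathcal M_n$. The map $\Phi:\mathcal M_d\to\mathcal M_{d'}$ is CQ if $\Phi(A)=\sum_{k=1}^{d}\operatorname{Tr}(|k\rangle\langle k|A)\,R_k$ for some orthonormal basis $\{|k\rangle\}$ of $\mathbb C^d$ and some positive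 semidefinite $R_1,\dots,R_d\in\mathcal M_{d'}$, and it is QC if $\Phi(A)=\sum_{k=1}^{d'}\operatorname{Tr}(X_kA)\,|k\rangle\langle k|$ for some positive semidefinite $X_1,\dots,X_{d'}\in\mathcal M_d$ and some orthonormal basis $\{|k\rangle\}$ of $\mathbb C^{d'}$. Theorem. Let $\Phi:\mathcal M_d\to\mathcal M_{d'}$ be a CQ map or a QC map. Then for all real $q,p\ge 1$ $$\|\Phi\|_{q\to p}^{(pot)}=\|\Phi\|_{q\to p},$$ and moreover $\|\Phi\otimes\Omega\|_{q\to p}=\|\Phi\|_{q\to p}\,\|\Omega\|_{q\to p}$ for all $n,n'\ge 1$ and every CP map $\Omega:\mathcal M_n\to\mathcal M_{n'}$. -/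

import Mathlib

open scoped Kronecker ENNReal ComplexOrder

noncomputable section

/-- The Schatten norm `‖A‖_p = (Tr |A|^p)^(1/p)` with `|A| = (A A*)^(1/2)`, both powers being taken
in the functional calculus of Hermitian matrices. -/
def schattenNorm {ι : Type*} [Fintype ι] [DecidableEq ι] (p : ℝ) (A : Matrix ι ι ℂ) : ℝ :=
  (cfc (fun x : ℝ => x ^ p) (cfc Real.sqrt (A * A.conjTranspose))).trace.re ^ (1 / p)

/-- The norm `‖L‖_{q → p}`, the supremum of `‖L(A)‖_p / ‖A‖_q` over all nonzero matrices `A`.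
It takes values in `[0, ∞]`, so that the supremum has no junk value. -/
def mapNorm {ι κ : Type*} [Fintype ι] [DecidableEq ι] [Fintype κ] [DecidableEq κ]
    (q p : ℝ) (L : Matrix ι ι ℂ →ₗ[ℂ] Matrix κ κ ℂ) : ℝ≥0∞ :=
  ⨆ (A : Matrix ι ι ℂ) (_ : A ≠ 0),
    ENNReal.ofReal (schattenNorm p (L A)) / ENNReal.ofReal (schattenNorm q A)

/-- The tensor product `L ⊗ M` of two maps on matrices; `M_ι ⊗ M_μ` is the algebra of matrices
indexed by `ι × μ`, and an elementary tensor is a Kronecker product. -/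
def tensorMap {ι κ μ ν : Type*} [Fintype ι] [DecidableEq ι] [Fintype μ] [DecidableEq μ]
    (L : Matrix ι ι ℂ →ₗ[ℂ] Matrix κ κ ℂ) (M : Matrix μ μ ℂ →ₗ[ℂ] Matrix ν ν ℂ) :
    Matrix (ι × μ) (ι × μ) ℂ →ₗ[ℂ] Matrix (κ × ν) (κ × ν) ℂ where
  toFun A := ∑ i, ∑ j, ∑ k, ∑ l,
    A (i, k) (j, l) • (L (Matrix.single i j 1) ⊗ₖ M (Matrix.single k l 1))
  map_add' A B := by
    simp only [Matrix.add_apply, add_smul, Finset.sum_add_distrib]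
  map_smul' c A := by
    simp only [Matrix.smul_apply, smul_eq_mul, mul_smul, Finset.smul_sum, RingHom.id_apply]

/-- The defining property of the tensor product: `(L ⊗ M)(A ⊗ B) = L(A) ⊗ M(B)`. -/
theorem tensorMap_kronecker {ι κ μ ν : Type*} [Fintype ι] [DecidableEq ι] [Fintype μ]
    [DecidableEq μ] (L : Matrix ι ι ℂ →ₗ[ℂ] Matrix κ κ ℂ) (M : Matrix μ μ ℂ →ₗ[ℂ] Matrix ν ν ℂ)
    (A : Matrix ι ι ℂ) (B : Matrix μ μ ℂ) :
    tensorMap L M (A ⊗ₖ B) = L A ⊗ₖ M B := by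
  have hL : L A = ∑ i, ∑ j, A i j • L (Matrix.single i j 1) := by
    conv_lhs => rw [Matrix.matrix_eq_sum_single A]
    simp only [map_sum, ← map_smul, Matrix.smul_single, smul_eq_mul, mul_one]
  have hM : M B = ∑ k, ∑ l, B k l • M (Matrix.single k l 1) := by
    conv_lhs => rw [Matrix.matrix_eq_sum_single B]
    simp only [map_sum, ← map_smul, Matrix.smul_single, smul_eq_mul, mul_one]
  ext ⟨a, b⟩ ⟨a', b'⟩
  rw [hL, hM]
  simp only [tensorMap, LinearMap.coe_mk, AddHom.coe_mk, Matrix.sum_apply, Matrix.smul_apply,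
    Matrix.kroneckerMap_apply, smul_eq_mul, Finset.sum_mul]
  simp only [Finset.mul_sum]
  refine Finset.sum_congr rfl fun i _ => Finset.sum_congr rfl fun j _ =>
    Finset.sum_congr rfl fun k _ => Finset.sum_congr rfl fun l _ => ?_
  ring

/-- Complete positivity: `id_n ⊗ L` preserves positive semidefiniteness, for every `n`. -/
def IsCP {ι κ : Type*} [Fintype ι] [DecidableEq ι]
    (L : Matrix ι ι ℂ →ₗ[ℂ] Matrix κ κ ℂ) : Prop :=
  ∀ (n : ℕ) (A : Matrix (Fin n × ι) (Fin n × ι) ℂ), A.PosSemidef →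
    (tensorMap (LinearMap.id : Matrix (Fin n) (Fin n) ℂ →ₗ[ℂ] Matrix (Fin n) (Fin n) ℂ)
      L A).PosSemidef

/-- The potential output purity of `Φ`: the supremum of `‖Φ ⊗ Ω‖_{q → p} / ‖Ω‖_{q → p}` over all
nonzero completely positive maps `Ω` on `n × n` matrices and all `n ≥ 1`. -/
def potPurity {ι κ : Type*} [Fintype ι] [DecidableEq ι] [Fintype κ] [DecidableEq κ]
    (q p : ℝ) (Φ : Matrix ι ι ℂ →ₗ[ℂ] Matrix κ κ ℂ) : ℝ≥0∞ :=
  ⨆ (n : ℕ) (_ : 1 ≤ n) (Ω : Matrix (Fin n) (Fin n) ℂ →ₗ[ℂ] Matrix (Fin n) (Fin n) ℂ)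
    (_ : IsCP Ω) (_ : Ω ≠ 0), mapNorm q p (tensorMap Φ Ω) / mapNorm q p Ω

/-- The map `A ↦ ∑ k, Tr(X k * A) R k`. -/
def measurePrepare {ι κ σ : Type*} [Fintype ι] [Fintype σ]
    (X : σ → Matrix ι ι ℂ) (R : σ → Matrix κ κ ℂ) : Matrix ι ι ℂ →ₗ[ℂ] Matrix κ κ ℂ where
  toFun A := ∑ k, (X k * A).trace • R k
  map_add' A B := by
    simp only [Matrix.mul_add, Matrix.trace_add, add_smul, Finset.sum_add_distrib]
  map_smul' c A := by
    simp only [Matrix.mul_smul, Matrix.trace_smul, smul_eq_mul, mul_smul, Finset.smul_sum,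
      RingHom.id_apply]

/-- The rank-one matrix `|v⟩⟨v|`. -/
def ketBra {ι : Type*} (v : EuclideanSpace ℂ ι) : Matrix ι ι ℂ :=
  Matrix.vecMulVec (fun i => v i) (fun i => star (v i))

/-- `Φ` is CQ: `Φ(A) = ∑ k, Tr(|k⟩⟨k| A) R k` for an orthonormal basis `|k⟩` of the input space
and positive semidefinite matrices `R k`. -/
def IsCQ {ι κ : Type*} [Fintype ι] [DecidableEq ι]
    (Φ : Matrix ι ι ℂ →ₗ[ℂ] Matrix κ κ ℂ) : Prop :=
  ∃ (b : OrthonormalBasis ι ℂ (EuclideanSpace ℂ ι)) (R : ι → Matrix κ κ ℂ),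
    (∀ k, (R k).PosSemidef) ∧ Φ = measurePrepare (fun k => ketBra (b k)) R

/-- `Φ` is QC: `Φ(A) = ∑ k, Tr(X k A) |k⟩⟨k|` for positive semidefinite matrices `X k` and an
orthonormal basis `|k⟩` of the output space. -/
def IsQC {ι κ : Type*} [Fintype ι] [Fintype κ] [DecidableEq κ]
    (Φ : Matrix ι ι ℂ →ₗ[ℂ] Matrix κ κ ℂ) : Prop :=
  ∃ (X : κ → Matrix ι ι ℂ) (b : OrthonormalBasis κ ℂ (EuclideanSpace ℂ κ)),
    (∀ k, (X k).PosSemidef) ∧ Φ = measurePrepare X (fun k => ketBra (b k))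

end

/-! Product inputs A ⊗ B show that ‖Φ ⊗ Ω‖ is at least ‖Φ‖‖Ω‖, so only the upper bound needs work.
With Φ(A) = ∑ Tr(X_k A) R_k one has (Φ ⊗ Ω)(A) = ∑ R_k ⊗ Ω(Z_k), where Z_k = Tr₁((X_k ⊗ 1)A). Put
x_k = ‖Z_k‖_q, so that ‖Ω(Z_k)‖_p ≤ ‖Ω‖ x_k. The aim is to replace the matrices in the second tensor
factor by the numbers x_k.

The core is `norm_trace_sum_kronecker_mul_le`: if the R_k are positive with ∑ R_k ≤ C and the Y_k
lie in the Schatten unit ball of exponent 1/θ, then ∑ R_k ⊗ Y_k, paired with the dual ball, is at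
most ‖C‖_{1/θ}. Factoring R_k = B_k* B_k turns the pairing into a value at θ of a function
holomorphic in the exponents; it is bounded by 1 on Re z = 0 and by Tr C^{1/θ} on Re z = 1, and the
three lines theorem interpolates.

CQ case: the Z_k are the diagonal blocks of A in the basis |k⟩. The core estimate
(`schattenNorm_sum_kronecker_le`) bounds the output by ‖Ω‖ ‖∑ x_k R_k‖_p = ‖Ω‖ ‖Φ(D)‖_p with D = ∑
x_k |k⟩⟨k|, and pinching gives ‖D‖_q ≤ ‖A‖_q.

QC case: the output is block diagonal with blocks Ω(Z_k), so it suffices to bound S = ∑ x_k^p by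
(‖Φ‖‖A‖_q)^p. Choosing Y_k dual to Z_k gives S = Tr((∑ x_k^{p-1} X_k ⊗ Y_k) A). The dual form of the
core estimate, `norm_trace_sum_kronecker_mul_le_mul_schattenNorm`, reduces this to testing ∑
x_k^{p-1} X_k against positive B, where Hölder's inequality yields S^{1-1/p} ‖Φ(B)‖_p. -/

noncomputable section

open Matrix

set_option linter.unusedSectionVars false

/-! ### Singular value decomposition and the Schatten norm -/

section Decomposition

variable {ι : Type*} [Fintype ι] [DecidableEq ι]

/-- The matrix whose columns are an orthonormal basis. -/
def basisMatrix (b : OrthonormalBasis ι ℂ (EuclideanSpace ℂ ι)) : Matrix ι ι ℂ :=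
  Matrix.of fun i k => b k i

theorem basisMatrix_mem (b : OrthonormalBasis ι ℂ (EuclideanSpace ℂ ι)) :
    basisMatrix b ∈ unitary (Matrix ι ι ℂ) := by
  have h : star (basisMatrix b) * basisMatrix b = 1 := by
    ext i j
    have := orthonormal_iff_ite.mp b.orthonormal i j
    rw [PiLp.inner_apply] at this
    simp only [RCLike.inner_apply] at this
    rw [Matrix.one_apply, ← this, Matrix.mul_apply]
    refine Finset.sum_congr rfl fun k _ => ?_
    simp [basisMatrix, Matrix.star_apply, mul_comm]
  exact Unitary.mem_iff.mpr ⟨h, mul_eq_one_comm.mp h⟩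

/-- The change of basis M between the given diagonalisation and the spectral one intertwines the two
diagonal matrices, so M i j ≠ 0 forces equal eigenvalues. Hence M also intertwines their images
under f. -/
theorem cfc_unitary_diagonal {U : Matrix ι ι ℂ} (hU : U ∈ unitary (Matrix ι ι ℂ)) (d : ι → ℝ)
    (f : ℝ → ℝ) :
    cfc f (U * diagonal (fun i => (d i : ℂ)) * star U) =
      U * diagonal (fun i => (f (d i) : ℂ)) * star U := by
  set H := U * diagonal (fun i => (d i : ℂ)) * star U with hHdef
  have hH : H.IsHermitian := by
    rw [Matrix.IsHermitian, hHdef, star_eq_conjTranspose, conjTranspose_mul, conjTranspose_mul,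
      conjTranspose_conjTranspose, diagonal_conjTranspose, Matrix.mul_assoc]
    congr 3
    funext i
    simp
  set W := (hH.eigenvectorUnitary : Matrix ι ι ℂ) with hW
  have hWm : W ∈ unitary (Matrix ι ι ℂ) := hH.eigenvectorUnitary.2
  have hsp : H = W * diagonal (fun i => (hH.eigenvalues i : ℂ)) * star W := by
    conv_lhs => rw [hH.spectral_theorem]
    rfl
  have hcfc : cfc f H = W * diagonal (fun i => (f (hH.eigenvalues i) : ℂ)) * star W := by
    rw [hH.cfc_eq]
    rfl
  rw [hcfc]
  have hUU := Unitary.mem_iff.mp hU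
  have hWW := Unitary.mem_iff.mp hWm
  set M := star U * W with hM
  have h1 : diagonal (fun i => (d i : ℂ)) * M = M * diagonal (fun i => (hH.eigenvalues i : ℂ)) := by
    have h2 : star U * H * W = diagonal (fun i => (d i : ℂ)) * M := by
      rw [hHdef, hM]
      simp only [← Matrix.mul_assoc]
      rw [hUU.1, Matrix.one_mul]
    have h3 : star U * H * W = M * diagonal (fun i => (hH.eigenvalues i : ℂ)) := by
      refine (congrArg (fun X => star U * X * W) hsp).trans ?_
      rw [hM]
      simp only [Matrix.mul_assoc]
      rw [hWW.1, Matrix.mul_one]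
    rw [← h2, h3]
  have h4 : diagonal (fun i => (f (d i) : ℂ)) * M =
      M * diagonal (fun i => (f (hH.eigenvalues i) : ℂ)) := by
    ext i j
    have h5 := congrFun (congrFun h1 i) j
    rw [diagonal_mul, mul_diagonal] at h5 ⊢
    by_cases h6 : M i j = 0
    · simp [h6]
    · have h7 : (d i : ℂ) = hH.eigenvalues j := by
        rw [mul_comm] at h5
        exact mul_left_cancel₀ h6 h5
      have h8 : d i = hH.eigenvalues j := by exact_mod_cast h7
      rw [h8, mul_comm]
  calc W * diagonal (fun i => (f (hH.eigenvalues i) : ℂ)) * star W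
      = U * (M * diagonal (fun i => (f (hH.eigenvalues i) : ℂ))) * star W := by
        rw [hM]
        simp only [← Matrix.mul_assoc]
        rw [hUU.2, Matrix.one_mul]
    _ = U * diagonal (fun i => (f (d i) : ℂ)) * star U := by
        rw [← h4, hM]
        simp only [Matrix.mul_assoc]
        rw [hWW.2, Matrix.mul_one]

theorem schattenNorm_svd {U V : Matrix ι ι ℂ} (hU : U ∈ unitary (Matrix ι ι ℂ))
    (hV : V ∈ unitary (Matrix ι ι ℂ)) {s : ι → ℝ} (hs : ∀ i, 0 ≤ s i) (p : ℝ) :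
    schattenNorm p (U * diagonal (fun i => (s i : ℂ)) * V) = (∑ i, s i ^ p) ^ (1 / p) := by
  have hVV := Unitary.mem_iff.mp hV
  have hUU := Unitary.mem_iff.mp hU
  have h1 : (U * diagonal (fun i => (s i : ℂ)) * V) *
      (U * diagonal (fun i => (s i : ℂ)) * V).conjTranspose =
      U * diagonal (fun i => ((s i ^ 2 : ℝ) : ℂ)) * star U := by
    have h2 : (diagonal (fun i => (s i : ℂ))).conjTranspose = diagonal (fun i => (s i : ℂ)) := by
      rw [diagonal_conjTranspose]
      congr 1
      funext i
      simp
    rw [conjTranspose_mul, conjTranspose_mul, h2, ← star_eq_conjTranspose, ← star_eq_conjTranspose]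
    calc _ = U * diagonal (fun i => (s i : ℂ)) * (V * star V) *
          diagonal (fun i => (s i : ℂ)) * star U := by
          simp only [Matrix.mul_assoc]
      _ = U * (diagonal (fun i => (s i : ℂ)) * diagonal (fun i => (s i : ℂ))) * star U := by
          rw [hVV.2, Matrix.mul_one]
          simp only [Matrix.mul_assoc]
      _ = _ := by
          rw [diagonal_mul_diagonal]
          congr 3
          funext i
          push_cast
          ring
  rw [schattenNorm, h1, cfc_unitary_diagonal hU, cfc_unitary_diagonal hU, trace_mul_cycle, hUU.1,
    Matrix.one_mul, trace_diagonal]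
  congr 1
  rw [Complex.re_sum]
  refine Finset.sum_congr rfl fun i _ => ?_
  rw [Real.sqrt_sq (hs i), Complex.ofReal_re]

/-- The images under A of an eigenbasis of A*A are orthogonal with squared lengths the eigenvalues.
Normalising the nonzero ones and completing to an orthonormal basis gives the left factor. -/
theorem exists_svd (A : Matrix ι ι ℂ) :
    ∃ U ∈ unitary (Matrix ι ι ℂ), ∃ V ∈ unitary (Matrix ι ι ℂ), ∃ s : ι → ℝ, (∀ i, 0 ≤ s i) ∧
      A = U * diagonal (fun i => (s i : ℂ)) * V := by
  have hP : (A.conjTranspose * A).PosSemidef := posSemidef_conjTranspose_mul_self A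
  set lam := hP.1.eigenvalues with hlam
  have hl : ∀ i, 0 ≤ lam i := hP.eigenvalues_nonneg
  set b := hP.1.eigenvectorBasis with hb
  let v : ι → EuclideanSpace ℂ ι := fun j => WithLp.toLp 2 (A *ᵥ (b j).ofLp)
  have hv : ∀ i j, inner ℂ (v i) (v j) = if i = j then (lam j : ℂ) else 0 := by
    intro i j
    have h1 : inner ℂ (v i) (v j) = (A *ᵥ (b j).ofLp) ⬝ᵥ star (A *ᵥ (b i).ofLp) := by
      rw [EuclideanSpace.inner_eq_star_dotProduct]
    have h2 : inner ℂ (b i) (b j) = (b j).ofLp ⬝ᵥ star (b i).ofLp := by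
      rw [EuclideanSpace.inner_eq_star_dotProduct]
    rw [h1, star_mulVec, dotProduct_comm, ← dotProduct_mulVec, mulVec_mulVec,
      hP.1.mulVec_eigenvectorBasis, dotProduct_smul, dotProduct_comm, ← hb, ← h2,
      orthonormal_iff_ite.mp b.orthonormal i j]
    split_ifs <;> simp [hlam]
  let s : Set ι := {j | lam j ≠ 0}
  let u : ι → EuclideanSpace ℂ ι := fun j => (((Real.sqrt (lam j))⁻¹ : ℝ) : ℂ) • v j
  have hu : Orthonormal ℂ (s.domRestrict u) := by
    rw [orthonormal_iff_ite]
    rintro ⟨i, hi⟩ ⟨j, hj⟩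
    simp only [Set.domRestrict_apply, u, inner_smul_left, inner_smul_right, hv, Subtype.mk.injEq]
    split_ifs with hij
    · subst hij
      rw [Complex.conj_ofReal]
      norm_cast
      rw [← mul_assoc, ← mul_inv, Real.mul_self_sqrt (hl i), inv_mul_cancel₀ hi]
    · simp
  obtain ⟨c, hc⟩ := hu.exists_orthonormalBasis_extension_of_card_eq (by simp)
  have hcv : ∀ j, v j = ((Real.sqrt (lam j) : ℝ) : ℂ) • c j := by
    intro j
    by_cases hj : lam j = 0
    · have := hv j j
      rw [if_pos rfl, hj, Complex.ofReal_zero, inner_self_eq_zero] at this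
      rw [this, hj]
      simp
    · rw [hc j hj]
      simp only [u]
      rw [smul_smul, ← Complex.ofReal_mul, mul_inv_cancel₀
        (Real.sqrt_ne_zero'.mpr (lt_of_le_of_ne (hl j) (Ne.symm hj))), Complex.ofReal_one, one_smul]
  refine ⟨basisMatrix c, basisMatrix_mem c, star (basisMatrix b),
    Unitary.star_mem (basisMatrix_mem b), fun j => Real.sqrt (lam j),
    fun j => Real.sqrt_nonneg _, ?_⟩
  have h3 : A * basisMatrix b = basisMatrix c * diagonal (fun i => ((Real.sqrt (lam i) : ℝ) : ℂ)) := by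
    ext i j
    rw [mul_diagonal]
    have := congrArg (fun x : EuclideanSpace ℂ ι => x i) (hcv j)
    simp only [v, PiLp.smul_apply, smul_eq_mul] at this
    rw [mul_comm]
    exact this
  rw [← h3, Matrix.mul_assoc, (Unitary.mem_iff.mp (basisMatrix_mem b)).2, Matrix.mul_one]

theorem schattenNorm_nonneg (p : ℝ) (A : Matrix ι ι ℂ) : 0 ≤ schattenNorm p A := by
  obtain ⟨U, hU, V, hV, s, hs, rfl⟩ := exists_svd A
  rw [schattenNorm_svd hU hV hs]
  exact Real.rpow_nonneg (Finset.sum_nonneg fun i _ => Real.rpow_nonneg (hs i) _) _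

theorem schattenNorm_unitary_mul_mul {G H : Matrix ι ι ℂ} (hG : G ∈ unitary (Matrix ι ι ℂ))
    (hH : H ∈ unitary (Matrix ι ι ℂ)) (p : ℝ) (A : Matrix ι ι ℂ) :
    schattenNorm p (G * A * H) = schattenNorm p A := by
  obtain ⟨U, hU, V, hV, s, hs, rfl⟩ := exists_svd A
  rw [schattenNorm_svd hU hV hs, ← schattenNorm_svd (mul_mem hG hU) (mul_mem hV hH) hs]
  simp only [Matrix.mul_assoc]

theorem schattenNorm_rpow_svd {U V : Matrix ι ι ℂ} (hU : U ∈ unitary (Matrix ι ι ℂ))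
    (hV : V ∈ unitary (Matrix ι ι ℂ)) {s : ι → ℝ} (hs : ∀ i, 0 ≤ s i) {p : ℝ} (hp : 1 ≤ p) :
    schattenNorm p (U * diagonal (fun i => (s i : ℂ)) * V) ^ p = ∑ i, s i ^ p := by
  rw [schattenNorm_svd hU hV hs, ← Real.rpow_mul, one_div, inv_mul_cancel₀ (by linarith),
    Real.rpow_one]
  exact Finset.sum_nonneg fun i _ => Real.rpow_nonneg (hs i) _

theorem schattenNorm_smul {p : ℝ} (hp : 1 ≤ p) {c : ℝ} (hc : 0 ≤ c) (A : Matrix ι ι ℂ) :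
    schattenNorm p ((c : ℂ) • A) = c * schattenNorm p A := by
  obtain ⟨U, hU, V, hV, s, hs, rfl⟩ := exists_svd A
  have h : (c : ℂ) • (U * diagonal (fun i => (s i : ℂ)) * V) =
      U * diagonal (fun i => ((c * s i : ℝ) : ℂ)) * V := by
    rw [← Matrix.smul_mul, ← Matrix.mul_smul, ← diagonal_smul]
    congr 3
    funext i
    simp
  rw [h, schattenNorm_svd hU hV hs, schattenNorm_svd hU hV fun i => mul_nonneg hc (hs i)]
  simp_rw [Real.mul_rpow hc (hs _)]
  rw [← Finset.mul_sum, Real.mul_rpow (Real.rpow_nonneg hc _)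
    (Finset.sum_nonneg fun i _ => Real.rpow_nonneg (hs i) _), ← Real.rpow_mul hc,
    mul_one_div_cancel (by linarith), Real.rpow_one]

theorem schattenNorm_eq_zero {p : ℝ} (hp : 1 ≤ p) {A : Matrix ι ι ℂ} (h : schattenNorm p A = 0) :
    A = 0 := by
  obtain ⟨U, hU, V, hV, s, hs, rfl⟩ := exists_svd A
  have h1 := schattenNorm_rpow_svd hU hV hs hp
  rw [h, Real.zero_rpow (by linarith), eq_comm,
    Finset.sum_eq_zero_iff_of_nonneg fun i _ => Real.rpow_nonneg (hs i) _] at h1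
  have h2 : (fun i => (s i : ℂ)) = 0 := by
    funext i
    have := h1 i (Finset.mem_univ i)
    rw [Real.rpow_eq_zero (hs i) (by linarith)] at this
    simp [this]
  rw [h2]
  simp

theorem schattenNorm_pos {p : ℝ} (hp : 1 ≤ p) {A : Matrix ι ι ℂ} (h : A ≠ 0) :
    0 < schattenNorm p A :=
  lt_of_le_of_ne (schattenNorm_nonneg p A) fun h' => h (schattenNorm_eq_zero hp h'.symm)

theorem schattenNorm_zero {p : ℝ} (hp : 1 ≤ p) : schattenNorm p (0 : Matrix ι ι ℂ) = 0 := by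
  simpa using schattenNorm_smul hp le_rfl (0 : Matrix ι ι ℂ)

theorem schattenNorm_kronecker {κ : Type*} [Fintype κ] [DecidableEq κ] {p : ℝ}
    (A : Matrix ι ι ℂ) (B : Matrix κ κ ℂ) :
    schattenNorm p (A ⊗ₖ B) = schattenNorm p A * schattenNorm p B := by
  obtain ⟨U, hU, V, hV, s, hs, rfl⟩ := exists_svd A
  obtain ⟨U', hU', V', hV', s', hs', rfl⟩ := exists_svd B
  have h : (U * diagonal (fun i => (s i : ℂ)) * V) ⊗ₖ (U' * diagonal (fun i => (s' i : ℂ)) * V') =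
      (U ⊗ₖ U') * diagonal (fun i : ι × κ => ((s i.1 * s' i.2 : ℝ) : ℂ)) * (V ⊗ₖ V') := by
    rw [mul_kronecker_mul, mul_kronecker_mul, diagonal_kronecker_diagonal]
    push_cast
    rfl
  rw [h, schattenNorm_svd hU hV hs, schattenNorm_svd hU' hV' hs',
    schattenNorm_svd (kronecker_mem_unitary hU hU') (kronecker_mem_unitary hV hV')
      fun i => mul_nonneg (hs _) (hs' _), ← Real.mul_rpow
      (Finset.sum_nonneg fun i _ => Real.rpow_nonneg (hs i) _)
      (Finset.sum_nonneg fun i _ => Real.rpow_nonneg (hs' i) _)]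
  congr 1
  rw [Fintype.sum_prod_type, Finset.sum_mul_sum]
  simp_rw [Real.mul_rpow (hs _) (hs' _)]

end Decomposition

/-! ### Pinching inequalities and block diagonal matrices -/

section Blocks

variable {ι μ : Type*} [Fintype ι] [DecidableEq ι] [Fintype μ] [DecidableEq μ]

theorem sum_norm_sq_row {U : Matrix ι ι ℂ} (hU : U ∈ unitary (Matrix ι ι ℂ)) (i : ι) :
    ∑ j, ‖U i j‖ ^ 2 = 1 := by
  have h := congrFun (congrFun (Unitary.mem_iff.mp hU).2 i) i
  rw [Matrix.mul_apply, Matrix.one_apply_eq] at h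
  have h2 : ((∑ j, ‖U i j‖ ^ 2 : ℝ) : ℂ) = 1 := by
    rw [← h]
    push_cast
    refine Finset.sum_congr rfl fun j _ => ?_
    rw [Matrix.star_apply, RCLike.star_def, Complex.mul_conj']
  exact_mod_cast h2

theorem sum_norm_sq_col {U : Matrix ι ι ℂ} (hU : U ∈ unitary (Matrix ι ι ℂ)) (j : ι) :
    ∑ i, ‖U i j‖ ^ 2 = 1 := by
  rw [← sum_norm_sq_row (Unitary.star_mem hU) j]
  simp [Matrix.star_apply]

theorem sum_norm_mul_norm_le {κ : Type*} [Fintype κ] {f g : κ → ℂ} (hf : ∑ i, ‖f i‖ ^ 2 ≤ 1)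
    (hg : ∑ i, ‖g i‖ ^ 2 ≤ 1) : ∑ i, ‖f i‖ * ‖g i‖ ≤ 1 := by
  have h : ∀ i, ‖f i‖ * ‖g i‖ ≤ (‖f i‖ ^ 2 + ‖g i‖ ^ 2) / 2 := fun i => by
    nlinarith [sq_nonneg (‖f i‖ - ‖g i‖)]
  refine (Finset.sum_le_sum fun i _ => h i).trans ?_
  rw [← Finset.sum_div, Finset.sum_add_distrib]
  linarith

theorem mul_diagonal_mul_apply {κ ν : Type*} (U : Matrix κ ι ℂ) (V : Matrix ι ν ℂ) (s : ι → ℂ)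
    (i : κ) (j : ν) :
    (U * diagonal s * V) i j = ∑ m, U i m * s m * V m j := by
  rw [Matrix.mul_apply]
  simp_rw [mul_diagonal]

/-- Pinching to the diagonal does not increase the Schatten norm. -/
theorem sum_norm_diag_rpow_le {q : ℝ} (hq : 1 ≤ q) (A : Matrix ι ι ℂ) :
    ∑ i, ‖A i i‖ ^ q ≤ schattenNorm q A ^ q := by
  obtain ⟨U, hU, V, hV, s, hs, rfl⟩ := exists_svd A
  rw [schattenNorm_rpow_svd hU hV hs hq]
  -- The weights |U i j| |V j i| are doubly substochastic. They dominate the diagonal entries by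
  -- averages of the singular values, and the weighted power mean inequality applies row by row.
  have hrow : ∀ i, ∑ j, ‖U i j‖ * ‖V j i‖ ≤ 1 := fun i =>
    sum_norm_mul_norm_le (sum_norm_sq_row hU i).le (sum_norm_sq_col hV i).le
  have hcol : ∀ j, ∑ i, ‖U i j‖ * ‖V j i‖ ≤ 1 := fun j =>
    sum_norm_mul_norm_le (sum_norm_sq_col hU j).le (sum_norm_sq_row hV j).le
  have hD : ∀ i j, 0 ≤ ‖U i j‖ * ‖V j i‖ := fun i j => by positivity
  have hsq : ∀ j, 0 ≤ s j ^ q := fun j => Real.rpow_nonneg (hs j) _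
  have h1 : ∀ i, ‖(U * diagonal (fun i => (s i : ℂ)) * V) i i‖ ^ q ≤
      ∑ j, ‖U i j‖ * ‖V j i‖ * s j ^ q := by
    intro i
    have h2 : ‖(U * diagonal (fun i => (s i : ℂ)) * V) i i‖ ≤ ∑ j, ‖U i j‖ * ‖V j i‖ * s j := by
      rw [mul_diagonal_mul_apply]
      refine (norm_sum_le _ _).trans (Finset.sum_le_sum fun j _ => le_of_eq ?_)
      rw [norm_mul, norm_mul, Complex.norm_real, Real.norm_of_nonneg (hs j)]
      ring
    have h3 := Real.inner_le_weight_mul_Lp_of_nonneg Finset.univ hq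
      (fun j => ‖U i j‖ * ‖V j i‖) s (hD i) hs
    have h4 : 0 ≤ ∑ j, ‖U i j‖ * ‖V j i‖ * s j ^ q :=
      Finset.sum_nonneg fun j _ => mul_nonneg (hD i j) (hsq j)
    have h5 : (∑ j, ‖U i j‖ * ‖V j i‖) ^ (1 - q⁻¹) ≤ 1 :=
      Real.rpow_le_one (Finset.sum_nonneg fun j _ => hD i j) (hrow i)
        (sub_nonneg.mpr (inv_le_one_of_one_le₀ hq))
    have h6 : ‖(U * diagonal (fun i => (s i : ℂ)) * V) i i‖ ≤
        (∑ j, ‖U i j‖ * ‖V j i‖ * s j ^ q) ^ q⁻¹ :=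
      (h2.trans h3).trans (mul_le_of_le_one_left (Real.rpow_nonneg h4 _) h5)
    refine (Real.rpow_le_rpow (norm_nonneg _) h6 (by linarith)).trans (le_of_eq ?_)
    rw [← Real.rpow_mul h4, inv_mul_cancel₀ (by linarith), Real.rpow_one]
  refine (Finset.sum_le_sum fun i _ => h1 i).trans ?_
  rw [Finset.sum_comm]
  refine Finset.sum_le_sum fun j _ => ?_
  rw [← Finset.sum_mul]
  exact mul_le_of_le_one_left (hsq j) (hcol j)

/-- The block diagonal matrix `∑ k, |k⟩⟨k| ⊗ M k`. -/
def diagBlocks (M : ι → Matrix μ μ ℂ) : Matrix (ι × μ) (ι × μ) ℂ :=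
  Matrix.of fun x y => if x.1 = y.1 then M x.1 x.2 y.2 else 0

/-- The diagonal block of index `k`. -/
def blockAt (A : Matrix (ι × μ) (ι × μ) ℂ) (k : ι) : Matrix μ μ ℂ :=
  Matrix.of fun i j => A (k, i) (k, j)

theorem diagBlocks_mul_mul_apply (M N : ι → Matrix μ μ ℂ) (A : Matrix (ι × μ) (ι × μ) ℂ) (k : ι)
    (i j : μ) :
    (diagBlocks M * A * diagBlocks N) (k, i) (k, j) = (M k * blockAt A k * N k) i j := by
  simp only [Matrix.mul_apply, diagBlocks, blockAt, Matrix.of_apply, Fintype.sum_prod_type,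
    ite_mul, mul_ite, zero_mul, mul_zero, Finset.sum_ite_irrel, Finset.sum_const_zero,
    Finset.sum_ite_eq, Finset.sum_ite_eq', Finset.mem_univ, if_true]

theorem diagBlocks_mul (M N : ι → Matrix μ μ ℂ) :
    diagBlocks M * diagBlocks N = diagBlocks fun k => M k * N k := by
  ext ⟨k, i⟩ ⟨l, j⟩
  simp only [Matrix.mul_apply, diagBlocks, Matrix.of_apply, Fintype.sum_prod_type,
    ite_mul, zero_mul, Finset.sum_ite_irrel, Finset.sum_const_zero,
    Finset.sum_ite_eq, Finset.mem_univ, if_true]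
  split_ifs with h
  · subst h; rfl
  · simp

theorem diagBlocks_mem_unitary {U : ι → Matrix μ μ ℂ} (hU : ∀ k, U k ∈ unitary (Matrix μ μ ℂ)) :
    diagBlocks U ∈ unitary (Matrix (ι × μ) (ι × μ) ℂ) := by
  have h1 : star (diagBlocks U) = diagBlocks fun k => star (U k) := by
    ext ⟨k, i⟩ ⟨l, j⟩
    by_cases h : k = l
    · subst h; simp [diagBlocks, Matrix.star_apply]
    · simp [diagBlocks, Matrix.star_apply, h, Ne.symm h]
  have h2 : diagBlocks (fun _ : ι => (1 : Matrix μ μ ℂ)) = 1 := by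
    ext ⟨k, i⟩ ⟨l, j⟩
    simp only [diagBlocks, Matrix.of_apply, Matrix.one_apply, Prod.mk.injEq, ite_and]
  refine Unitary.mem_iff.mpr ⟨?_, ?_⟩ <;>
  · rw [h1, diagBlocks_mul, ← h2]
    congr 1
    funext k
    first | exact (Unitary.mem_iff.mp (hU k)).1 | exact (Unitary.mem_iff.mp (hU k)).2

theorem diagBlocks_diagonal (s : ι → μ → ℂ) :
    diagBlocks (fun k => diagonal (s k)) = diagonal fun x : ι × μ => s x.1 x.2 := by
  ext ⟨k, i⟩ ⟨l, j⟩
  simp only [diagBlocks, Matrix.of_apply, Matrix.diagonal_apply, Prod.mk.injEq, ite_and]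

theorem schattenNorm_diagBlocks_rpow {p : ℝ} (hp : 1 ≤ p) (Y : ι → Matrix μ μ ℂ) :
    schattenNorm p (diagBlocks Y) ^ p = ∑ k, schattenNorm p (Y k) ^ p := by
  choose U hU V hV s hs hY using fun k => exists_svd (Y k)
  have h : diagBlocks Y =
      diagBlocks U * diagonal (fun x : ι × μ => (s x.1 x.2 : ℂ)) * diagBlocks V := by
    rw [← diagBlocks_diagonal fun k i => (s k i : ℂ), diagBlocks_mul, diagBlocks_mul]
    congr 1
    funext k
    exact hY k
  rw [h, schattenNorm_rpow_svd (diagBlocks_mem_unitary hU) (diagBlocks_mem_unitary hV)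
    (fun x => hs x.1 x.2) hp, Fintype.sum_prod_type]
  refine Finset.sum_congr rfl fun k _ => ?_
  rw [hY k, schattenNorm_rpow_svd (hU k) (hV k) (hs k) hp]

/-- Pinching to the diagonal blocks does not increase the Schatten norm. -/
theorem sum_schattenNorm_blockAt_rpow_le {q : ℝ} (hq : 1 ≤ q) (A : Matrix (ι × μ) (ι × μ) ℂ) :
    ∑ k, schattenNorm q (blockAt A k) ^ q ≤ schattenNorm q A ^ q := by
  -- Block diagonal unitaries built from the decompositions of the blocks make the singular values
  -- of the blocks appear as diagonal entries. This reduces the claim to pinching onto the diagonal.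
  choose U hU V hV s hs hY using fun k => exists_svd (blockAt A k)
  rw [← schattenNorm_unitary_mul_mul (diagBlocks_mem_unitary fun k => Unitary.star_mem (hU k))
    (diagBlocks_mem_unitary fun k => Unitary.star_mem (hV k)) q A]
  refine le_trans (le_of_eq ?_) (sum_norm_diag_rpow_le hq _)
  rw [Fintype.sum_prod_type]
  refine Finset.sum_congr rfl fun k _ => ?_
  rw [hY k, schattenNorm_rpow_svd (hU k) (hV k) (hs k) hq]
  refine Finset.sum_congr rfl fun i _ => ?_
  rw [diagBlocks_mul_mul_apply, hY k]
  have h : star (U k) * (U k * diagonal (fun i => (s k i : ℂ)) * V k) * star (V k) =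
      diagonal (fun i => (s k i : ℂ)) := by
    calc _ = (star (U k) * U k) * diagonal (fun i => (s k i : ℂ)) * (V k * star (V k)) := by
          simp only [Matrix.mul_assoc]
      _ = _ := by
          rw [(Unitary.mem_iff.mp (hU k)).1, (Unitary.mem_iff.mp (hV k)).2, Matrix.one_mul,
            Matrix.mul_one]
  rw [h, diagonal_apply_eq, Complex.norm_real, Real.norm_of_nonneg (hs k i)]

/-- A crude comparison with matrix entries; with `schattenNorm_le_sum_norm` it serves to show that
map norms are finite. -/
theorem norm_apply_le_schattenNorm {q : ℝ} (hq : 1 ≤ q) (A : Matrix ι ι ℂ) (i j : ι) :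
    ‖A i j‖ ≤ schattenNorm q A := by
  obtain ⟨U, hU, V, hV, s, hs, rfl⟩ := exists_svd A
  have hs' : ∀ m, s m ≤ schattenNorm q (U * diagonal (fun i => (s i : ℂ)) * V) := fun m => by
    rw [← Real.rpow_le_rpow_iff (hs m) (schattenNorm_nonneg _ _) (by linarith : 0 < q),
      schattenNorm_rpow_svd hU hV hs hq]
    exact Finset.single_le_sum (f := fun i => s i ^ q) (fun i _ => Real.rpow_nonneg (hs i) _)
      (Finset.mem_univ m)
  rw [mul_diagonal_mul_apply]
  refine (norm_sum_le _ _).trans ?_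
  calc ∑ m, ‖U i m * (s m : ℂ) * V m j‖
      ≤ ∑ m, ‖U i m‖ * ‖V m j‖ * schattenNorm q (U * diagonal (fun i => (s i : ℂ)) * V) := by
        refine Finset.sum_le_sum fun m _ => ?_
        rw [norm_mul, norm_mul, Complex.norm_real, Real.norm_of_nonneg (hs m), mul_right_comm]
        exact mul_le_mul_of_nonneg_left (hs' m) (by positivity)
    _ ≤ _ := by
        rw [← Finset.sum_mul]
        exact mul_le_of_le_one_left (schattenNorm_nonneg _ _) (sum_norm_mul_norm_le
          (sum_norm_sq_row hU i).le (sum_norm_sq_col hV j).le)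

theorem schattenNorm_le_sum_norm {p : ℝ} (hp : 1 ≤ p) (A : Matrix ι ι ℂ) :
    schattenNorm p A ≤ (Fintype.card ι : ℝ) ^ (1 / p) * ∑ i, ∑ j, ‖A i j‖ := by
  obtain ⟨U, hU, V, hV, s, hs, hA⟩ := exists_svd A
  set N := ∑ i, ∑ j, ‖A i j‖ with hN
  have hN0 : 0 ≤ N := by positivity
  have h : star U * A * star V = diagonal (fun i => (s i : ℂ)) := by
    calc _ = (star U * U) * diagonal (fun i => (s i : ℂ)) * (V * star V) := by
          rw [hA]
          simp only [Matrix.mul_assoc]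
      _ = _ := by
          rw [(Unitary.mem_iff.mp hU).1, (Unitary.mem_iff.mp hV).2, Matrix.one_mul,
            Matrix.mul_one]
  have hsN : ∀ m, s m ≤ N := fun m => by
    have h1 : s m = ‖(star U * A * star V) m m‖ := by
      rw [h, diagonal_apply_eq, Complex.norm_real, Real.norm_of_nonneg (hs m)]
    rw [h1, Matrix.mul_apply]
    simp_rw [Matrix.mul_apply, Finset.sum_mul]
    rw [Finset.sum_comm, hN]
    refine (norm_sum_le _ _).trans (Finset.sum_le_sum fun i _ => ?_)
    refine (norm_sum_le _ _).trans (Finset.sum_le_sum fun j _ => ?_)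
    rw [norm_mul, norm_mul]
    have h2 : ‖star U m i‖ ≤ 1 := entry_norm_bound_of_unitary (Unitary.star_mem hU) m i
    have h3 : ‖star V j m‖ ≤ 1 := entry_norm_bound_of_unitary (Unitary.star_mem hV) j m
    have h4 := norm_nonneg (A i j)
    calc ‖star U m i‖ * ‖A i j‖ * ‖star V j m‖ ≤ 1 * ‖A i j‖ * 1 := by gcongr
      _ = ‖A i j‖ := by ring
  rw [hA, schattenNorm_svd hU hV hs]
  calc (∑ i, s i ^ p) ^ (1 / p) ≤ (∑ _i : ι, N ^ p) ^ (1 / p) := by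
        refine Real.rpow_le_rpow (Finset.sum_nonneg fun i _ => Real.rpow_nonneg (hs i) _)
          (Finset.sum_le_sum fun i _ => Real.rpow_le_rpow (hs i) (hsN i) (by linarith))
          (by positivity)
    _ = _ := by
        rw [Finset.sum_const, Finset.card_univ, nsmul_eq_mul,
          Real.mul_rpow (by positivity) (by positivity), ← Real.rpow_mul hN0,
          mul_one_div_cancel (by linarith), Real.rpow_one]

end Blocks

/-! ### Complex powers on the support and the three lines theorem -/

section ComplexPowers

/-- The power `x ^ z` with the convention `0 ^ z = 0` for every `z`, which is entire in `z`. -/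
def suppCpow (x : ℝ) (z : ℂ) : ℂ := if x = 0 then 0 else Complex.exp (z * Real.log x)

/-- The power `x ^ t` with the convention `0 ^ t = 0` for every `t`. -/
def suppRpow (x t : ℝ) : ℝ := if x = 0 then 0 else x ^ t

theorem suppRpow_one (x : ℝ) : suppRpow x 1 = x := by
  unfold suppRpow
  split_ifs with h <;> simp [h]

theorem suppRpow_zero_le (x : ℝ) : suppRpow x 0 ≤ 1 := by
  unfold suppRpow
  split_ifs <;> simp

theorem suppRpow_of_pos {x : ℝ} (hx : 0 < x) (t : ℝ) : suppRpow x t = x ^ t := by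
  rw [suppRpow, if_neg hx.ne']

theorem suppRpow_of_ne_zero {x t : ℝ} (ht : t ≠ 0) : suppRpow x t = x ^ t := by
  unfold suppRpow
  split_ifs with h
  · rw [h, Real.zero_rpow ht]
  · rfl

theorem suppRpow_le {x t : ℝ} (hx : 0 ≤ x) (h0 : 0 ≤ t) (h1 : t ≤ 1) : suppRpow x t ≤ 1 + x := by
  unfold suppRpow
  split_ifs
  · positivity
  · rcases le_total x 1 with h | h
    · exact (Real.rpow_le_one hx h h0).trans (by linarith)
    · exact (Real.rpow_le_rpow_of_exponent_le h h1).trans (by rw [Real.rpow_one]; linarith)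

theorem norm_suppCpow {x : ℝ} (hx : 0 ≤ x) (z : ℂ) : ‖suppCpow x z‖ = suppRpow x z.re := by
  unfold suppCpow suppRpow
  split_ifs with h
  · simp
  · rw [Complex.norm_exp, Complex.mul_re, Complex.ofReal_re, Complex.ofReal_im, mul_zero, sub_zero,
      Real.rpow_def_of_pos (lt_of_le_of_ne hx (Ne.symm h)), mul_comm]

theorem suppCpow_ofReal {x : ℝ} (hx : 0 ≤ x) (t : ℝ) : suppCpow x t = suppRpow x t := by
  unfold suppCpow suppRpow
  split_ifs with h
  · simp
  · rw [Real.rpow_def_of_pos (lt_of_le_of_ne hx (Ne.symm h)), mul_comm]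
    push_cast
    rfl

/-- Entire functions that are bounded on the strip `0 ≤ re z ≤ 1`. -/
def EntireBddOnStrip (f : ℂ → ℂ) : Prop :=
  Differentiable ℂ f ∧ ∃ C, ∀ z : ℂ, 0 ≤ z.re → z.re ≤ 1 → ‖f z‖ ≤ C

namespace EntireBddOnStrip

theorem const (c : ℂ) : EntireBddOnStrip fun _ => c :=
  ⟨differentiable_const c, ‖c‖, fun _ _ _ => le_rfl⟩

theorem mul {f g : ℂ → ℂ} (hf : EntireBddOnStrip f) (hg : EntireBddOnStrip g) :
    EntireBddOnStrip fun z => f z * g z := by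
  obtain ⟨hf, C, hC⟩ := hf
  obtain ⟨hg, D, hD⟩ := hg
  refine ⟨hf.mul hg, C * D, fun z h0 h1 => ?_⟩
  rw [norm_mul]
  exact mul_le_mul (hC z h0 h1) (hD z h0 h1) (norm_nonneg _) ((norm_nonneg _).trans (hC z h0 h1))

theorem sum {κ : Type*} [Fintype κ] {f : κ → ℂ → ℂ} (hf : ∀ k, EntireBddOnStrip (f k)) :
    EntireBddOnStrip fun z => ∑ k, f k z := by
  choose h C hC using hf
  exact ⟨Differentiable.fun_sum fun k _ => h k, ∑ k, C k, fun z h0 h1 =>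
    (norm_sum_le _ _).trans (Finset.sum_le_sum fun k _ => hC k z h0 h1)⟩

theorem suppCpow {x : ℝ} (hx : 0 ≤ x) {l : ℂ → ℂ} (hl : Differentiable ℂ l)
    (h : ∀ z : ℂ, 0 ≤ z.re → z.re ≤ 1 → 0 ≤ (l z).re ∧ (l z).re ≤ 1) :
    EntireBddOnStrip fun z => suppCpow x (l z) := by
  refine ⟨?_, 1 + x, fun z h0 h1 => ?_⟩
  · unfold _root_.suppCpow
    split_ifs
    · exact differentiable_const 0
    · fun_prop
  · rw [norm_suppCpow hx]
    exact suppRpow_le hx (h z h0 h1).1 (h z h0 h1).2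

/-- The three lines theorem, with bound `1` on the left and `b` on the right. -/
theorem norm_le_rpow {f : ℂ → ℂ} (hf : EntireBddOnStrip f) {b : ℝ}
    (h0 : ∀ z : ℂ, z.re = 0 → ‖f z‖ ≤ 1) (h1 : ∀ z : ℂ, z.re = 1 → ‖f z‖ ≤ b) {t : ℝ}
    (ht0 : 0 ≤ t) (ht1 : t ≤ 1) : ‖f t‖ ≤ b ^ t := by
  obtain ⟨hd, C, hC⟩ := hf
  have := Complex.HadamardThreeLines.norm_le_interp_of_mem_verticalClosedStrip₀₁' f (z := (t : ℂ))
    (a := 1) (b := b) ⟨by simpa using ht0, by simpa using ht1⟩ hd.diffContOnCl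
    ⟨C, by rintro _ ⟨z, hz, rfl⟩; exact hC z hz.1 hz.2⟩ h0 h1
  simpa using this

end EntireBddOnStrip

end ComplexPowers

/-! ### Complex interpolation of the trace pairing -/

section Interpolation

variable {ι μ K : Type*} [Fintype ι] [DecidableEq ι] [Fintype μ] [DecidableEq μ] [Fintype K]

theorem sum_norm_sq_mulVec {U : Matrix ι ι ℂ} (hU : U ∈ unitary (Matrix ι ι ℂ)) (y : ι → ℂ) :
    ∑ j, ‖∑ b, U j b * y b‖ ^ 2 = ∑ b, ‖y b‖ ^ 2 := by
  have h : ∀ v : ι → ℂ, ((∑ j, ‖v j‖ ^ 2 : ℝ) : ℂ) = star v ⬝ᵥ v := fun v => by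
    push_cast
    refine Finset.sum_congr rfl fun j _ => ?_
    rw [Pi.star_apply, RCLike.star_def, Complex.conj_mul']
  have h2 : ((∑ j, ‖(U *ᵥ y) j‖ ^ 2 : ℝ) : ℂ) = ((∑ b, ‖y b‖ ^ 2 : ℝ) : ℂ) := by
    rw [h, h, star_mulVec, ← dotProduct_mulVec, mulVec_mulVec, ← star_eq_conjTranspose,
      (Unitary.mem_iff.mp hU).1, one_mulVec]
  exact_mod_cast h2

theorem transpose_mem_unitary {U : Matrix ι ι ℂ} (hU : U ∈ unitary (Matrix ι ι ℂ)) :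
    Uᵀ ∈ unitary (Matrix ι ι ℂ) := by
  have h := Unitary.mem_iff.mp hU
  refine Unitary.mem_iff.mpr ⟨?_, ?_⟩
  · change (star U)ᵀ * Uᵀ = 1
    rw [← transpose_mul, h.2, transpose_one]
  · change Uᵀ * (star U)ᵀ = 1
    rw [← transpose_mul, h.1, transpose_one]

/-- The Bessel inequality for a family of vectors of total weight at most the identity. -/
def IsBessel (ρ : K → ι → ℂ) : Prop :=
  ∀ x : ι → ℂ, ∑ k, ‖∑ a, ρ k a * x a‖ ^ 2 ≤ ∑ a, ‖x a‖ ^ 2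

theorem IsBessel.conj {ρ : K → ι → ℂ} (h : IsBessel ρ) : IsBessel fun k a => star (ρ k a) := by
  intro x
  have := h fun a => star (x a)
  simp only [norm_star] at this
  refine le_trans (le_of_eq ?_) this
  refine Finset.sum_congr rfl fun k _ => ?_
  rw [← norm_star, star_sum]
  simp

theorem IsBessel.sum_norm_sq_le {ρ : K → ι → ℂ} (h : IsBessel ρ) (a : ι) :
    ∑ k, ‖ρ k a‖ ^ 2 ≤ 1 := by
  have h1 := h (Pi.single a 1)
  have h2 : ∑ b, ‖(Pi.single a 1 : ι → ℂ) b‖ ^ 2 = 1 := by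
    rw [Finset.sum_eq_single a]
    · simp
    · intro b _ hb; simp [hb]
    · simp
  rw [h2] at h1
  simpa [Pi.single_apply] using h1

/-- The matrix element `⟨r ⊗ v | X⟩`, where `v` is row `j` of `V` and `r = t ρ`. -/
def sliceCoeff (ρ : ι → ℂ) (V : Matrix μ μ ℂ) (t : ι → ℂ) (X : ι × μ → ℂ) (j : μ) : ℂ :=
  ∑ b, V j b * ∑ a, ρ a * (t a * X (a, b))

/-- The estimate for the line Re z = 0: each unitary V k preserves the sum over j, and the Bessel
inequality is applied for each index of the second tensor factor. -/
theorem sum_norm_sq_sliceCoeff_le {ρ : K → ι → ℂ} (hρ : IsBessel ρ) {V : K → Matrix μ μ ℂ}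
    (hV : ∀ k, V k ∈ unitary (Matrix μ μ ℂ)) {t : ι → ℂ} (ht : ∀ a, ‖t a‖ ≤ 1) {X : ι × μ → ℂ}
    (hX : ∑ x, ‖X x‖ ^ 2 ≤ 1) :
    ∑ x : K × μ, ‖sliceCoeff (ρ x.1) (V x.1) t X x.2‖ ^ 2 ≤ 1 := by
  rw [Fintype.sum_prod_type]
  simp only [sliceCoeff]
  simp_rw [sum_norm_sq_mulVec (hV _)]
  rw [Finset.sum_comm]
  refine le_trans ?_ hX
  rw [Fintype.sum_prod_type_right]
  refine Finset.sum_le_sum fun b _ => (hρ fun a => t a * X (a, b)).trans ?_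
  refine Finset.sum_le_sum fun a _ => ?_
  rw [norm_mul]
  exact pow_le_pow_left₀ (by positivity) (mul_le_of_le_one_left (norm_nonneg _) (ht a)) 2

/-- The estimate for the line Re z = 1: as m varies, the coefficients are those of W applied to one
fixed product vector, whose length W preserves. -/
theorem sum_norm_sq_sliceCoeff_unitary (ρ : ι → ℂ) {V : Matrix μ μ ℂ}
    (hV : V ∈ unitary (Matrix μ μ ℂ)) (t : ι → ℂ) {W : Matrix (ι × μ) (ι × μ) ℂ}
    (hW : W ∈ unitary (Matrix (ι × μ) (ι × μ) ℂ)) (j : μ) :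
    ∑ m, ‖sliceCoeff ρ V t (W m) j‖ ^ 2 = ∑ a, ‖t a‖ ^ 2 * ‖ρ a‖ ^ 2 := by
  have h : ∀ m, sliceCoeff ρ V t (W m) j = ∑ x, W m x * (V j x.2 * ρ x.1 * t x.1) := fun m => by
    rw [sliceCoeff, Fintype.sum_prod_type_right]
    refine Finset.sum_congr rfl fun b _ => ?_
    rw [Finset.mul_sum]
    refine Finset.sum_congr rfl fun a _ => ?_
    ring
  simp_rw [h]
  rw [sum_norm_sq_mulVec hW fun x => V j x.2 * ρ x.1 * t x.1, Fintype.sum_prod_type]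
  refine Finset.sum_congr rfl fun a _ => ?_
  simp_rw [norm_mul, mul_pow, mul_assoc]
  rw [← Finset.sum_mul, sum_norm_sq_row hV j]
  ring

/-- The left side is |F(θ)|, where F replaces θ by z in every exponent. For Re z = 0 the powers of η
and γ have modulus at most 1 while the w m have total mass at most 1. For Re z = 1 the roles of η
and w are exchanged, and the powers of γ contribute ∑ γ a. -/
theorem norm_interpolated_sum_le {θ : ℝ} (hθ0 : 0 ≤ θ) (hθ1 : θ ≤ 1) {γ : ι → ℝ}
    (hγ : ∀ a, 0 < γ a) {ρ : K → ι → ℂ} (hρ : IsBessel ρ) {U V : K → Matrix μ μ ℂ}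
    (hU : ∀ k, U k ∈ unitary (Matrix μ μ ℂ)) (hV : ∀ k, V k ∈ unitary (Matrix μ μ ℂ))
    {η : K → μ → ℝ} (hη : ∀ k j, 0 ≤ η k j) (hη1 : ∀ k, ∑ j, η k j ≤ 1)
    {U' V' : Matrix (ι × μ) (ι × μ) ℂ} (hU' : U' ∈ unitary (Matrix (ι × μ) (ι × μ) ℂ))
    (hV' : V' ∈ unitary (Matrix (ι × μ) (ι × μ) ℂ)) {w : ι × μ → ℝ} (hw : ∀ m, 0 ≤ w m)
    (hw1 : ∑ m, w m ≤ 1) :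
    ‖∑ k, ∑ j, ∑ m, ((suppRpow (η k j) θ : ℝ) : ℂ) * ((suppRpow (w m) (1 - θ) : ℝ) : ℂ) *
      (sliceCoeff (fun a => star (ρ k a)) (V k) (fun a => ((γ a ^ (θ / 2) : ℝ) : ℂ)) (U'ᵀ m) j *
        sliceCoeff (ρ k) (U k)ᵀ (fun a => ((γ a ^ (θ / 2) : ℝ) : ℂ)) (V' m) j)‖ ≤
      (∑ a, γ a) ^ θ := by
  -- Both factors carry γ^{z/2} unconjugated; conjugating one of them would destroy holomorphy.
  let α : K → μ → ι × μ → ℂ → ℂ := fun k j m z =>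
    sliceCoeff (fun a => star (ρ k a)) (V k) (fun a => suppCpow (γ a) (z / 2)) (U'ᵀ m) j
  let β : K → μ → ι × μ → ℂ → ℂ := fun k j m z =>
    sliceCoeff (ρ k) (U k)ᵀ (fun a => suppCpow (γ a) (z / 2)) (V' m) j
  let F : ℂ → ℂ := fun z => ∑ k, ∑ j, ∑ m,
    suppCpow (η k j) z * suppCpow (w m) (1 - z) * (α k j m z * β k j m z)
  have hslice : ∀ (ρ : ι → ℂ) (V : Matrix μ μ ℂ) (X : ι × μ → ℂ) (j : μ),
      EntireBddOnStrip fun z => sliceCoeff ρ V (fun a => suppCpow (γ a) (z / 2)) X j := by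
    intro ρ V X j
    refine .sum fun b => .mul (.const _) (.sum fun a => .mul (.const _) (.mul ?_ (.const _)))
    refine .suppCpow (hγ a).le (by fun_prop) fun z h0 h1 => ?_
    rw [Complex.div_ofNat_re]
    constructor <;> linarith
  have hF : EntireBddOnStrip F := by
    refine .sum fun k => .sum fun j => .sum fun m => .mul (.mul ?_ ?_)
      (.mul (hslice _ _ _ _) (hslice _ _ _ _))
    · exact .suppCpow (hη k j) differentiable_id fun z h0 h1 => ⟨h0, h1⟩
    · refine .suppCpow (hw m) (by fun_prop) fun z h0 h1 => ?_
      rw [Complex.sub_re, Complex.one_re]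
      constructor <;> linarith
  have hnorm : ∀ z, ‖F z‖ ≤ ∑ k, ∑ j, ∑ m,
      suppRpow (η k j) z.re * suppRpow (w m) (1 - z.re) * (‖α k j m z‖ * ‖β k j m z‖) := by
    intro z
    refine (norm_sum_le _ _).trans (Finset.sum_le_sum fun k _ => ?_)
    refine (norm_sum_le _ _).trans (Finset.sum_le_sum fun j _ => ?_)
    refine (norm_sum_le _ _).trans (Finset.sum_le_sum fun m _ => ?_)
    rw [norm_mul, norm_mul, norm_mul, norm_suppCpow (hη k j), norm_suppCpow (hw m),
      Complex.sub_re, Complex.one_re]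
  have hzero : ∀ z : ℂ, z.re = 0 → ‖F z‖ ≤ 1 := by
    intro z hz
    have ht : ∀ a, ‖suppCpow (γ a) (z / 2)‖ ≤ 1 := fun a => by
      rw [norm_suppCpow (hγ a).le, Complex.div_ofNat_re, hz, zero_div]
      exact suppRpow_zero_le _
    refine (hnorm z).trans ?_
    rw [hz, sub_zero]
    calc _ ≤ ∑ k, ∑ j, ∑ m, w m * (‖α k j m z‖ * ‖β k j m z‖) := by
          refine Finset.sum_le_sum fun k _ => Finset.sum_le_sum fun j _ =>
            Finset.sum_le_sum fun m _ => mul_le_mul_of_nonneg_right ?_ (by positivity)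
          rw [suppRpow_one]
          exact mul_le_of_le_one_left (hw m) (suppRpow_zero_le _)
      _ = ∑ m, w m * ∑ x : K × μ, ‖α x.1 x.2 m z‖ * ‖β x.1 x.2 m z‖ := by
          rw [← Fintype.sum_prod_type'
            (f := fun k j => ∑ m, w m * (‖α k j m z‖ * ‖β k j m z‖)), Finset.sum_comm]
          simp_rw [Finset.mul_sum]
      -- For fixed m, Cauchy–Schwarz over all pairs (k, j); column m of U' and row m of V' are unit
      -- vectors.
      _ ≤ ∑ m, w m * 1 := by
          refine Finset.sum_le_sum fun m _ => mul_le_mul_of_nonneg_left ?_ (hw m)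
          refine sum_norm_mul_norm_le ?_ ?_
          · exact sum_norm_sq_sliceCoeff_le hρ.conj hV ht (sum_norm_sq_col hU' m).le
          · exact sum_norm_sq_sliceCoeff_le hρ (fun k => transpose_mem_unitary (hU k)) ht
              (sum_norm_sq_row hV' m).le
      _ ≤ 1 := by simpa using hw1
  have hone : ∀ z : ℂ, z.re = 1 → ‖F z‖ ≤ ∑ a, γ a := by
    intro z hz
    have ht : ∀ a, ‖suppCpow (γ a) (z / 2)‖ ^ 2 = γ a := fun a => by
      rw [norm_suppCpow (hγ a).le, Complex.div_ofNat_re, hz, suppRpow_of_pos (hγ a),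
        ← Real.sqrt_eq_rpow, Real.sq_sqrt (hγ a).le]
    -- Here the sum over m is taken first, for fixed k and j, since now the η k j supply the
    -- convergent weights.
    have hαβ : ∀ k j, ∑ m, ‖α k j m z‖ * ‖β k j m z‖ ≤ ∑ a, γ a * ‖ρ k a‖ ^ 2 := by
      intro k j
      have hα := sum_norm_sq_sliceCoeff_unitary (fun a => star (ρ k a)) (hV k)
        (fun a => suppCpow (γ a) (z / 2)) (transpose_mem_unitary hU') j
      have hβ := sum_norm_sq_sliceCoeff_unitary (ρ k) (transpose_mem_unitary (hU k))
        (fun a => suppCpow (γ a) (z / 2)) hV' j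
      simp only [ht, norm_star] at hα hβ
      have h : ∀ m, ‖α k j m z‖ * ‖β k j m z‖ ≤ (‖α k j m z‖ ^ 2 + ‖β k j m z‖ ^ 2) / 2 :=
        fun m => by nlinarith [sq_nonneg (‖α k j m z‖ - ‖β k j m z‖)]
      refine (Finset.sum_le_sum fun m _ => h m).trans ?_
      rw [← Finset.sum_div, Finset.sum_add_distrib]
      change (∑ m, ‖α k j m z‖ ^ 2) = _ at hα
      change (∑ m, ‖β k j m z‖ ^ 2) = _ at hβ
      linarith
    have hc : ∀ k, 0 ≤ ∑ a, γ a * ‖ρ k a‖ ^ 2 := fun k =>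
      Finset.sum_nonneg fun a _ => mul_nonneg (hγ a).le (sq_nonneg _)
    refine (hnorm z).trans ?_
    rw [hz, sub_self]
    calc _ ≤ ∑ k, ∑ j, ∑ m, η k j * (‖α k j m z‖ * ‖β k j m z‖) := by
          refine Finset.sum_le_sum fun k _ => Finset.sum_le_sum fun j _ =>
            Finset.sum_le_sum fun m _ => mul_le_mul_of_nonneg_right ?_ (by positivity)
          rw [suppRpow_one]
          exact mul_le_of_le_one_right (hη k j) (suppRpow_zero_le _)
      _ ≤ ∑ k, ∑ j, η k j * ∑ a, γ a * ‖ρ k a‖ ^ 2 := by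
          refine Finset.sum_le_sum fun k _ => Finset.sum_le_sum fun j _ => ?_
          rw [← Finset.mul_sum]
          exact mul_le_mul_of_nonneg_left (hαβ k j) (hη k j)
      _ ≤ ∑ k, ∑ a, γ a * ‖ρ k a‖ ^ 2 := by
          refine Finset.sum_le_sum fun k _ => ?_
          rw [← Finset.sum_mul]
          exact mul_le_of_le_one_left (hc k) (hη1 k)
      _ = ∑ a, γ a * ∑ k, ‖ρ k a‖ ^ 2 := by
          rw [Finset.sum_comm]
          simp_rw [Finset.mul_sum]
      _ ≤ ∑ a, γ a := Finset.sum_le_sum fun a _ =>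
          mul_le_of_le_one_right (hγ a).le (hρ.sum_norm_sq_le a)
  have hfin := hF.norm_le_rpow hzero hone hθ0 hθ1
  have ht : (fun a => suppCpow (γ a) ((θ : ℂ) / 2)) = fun a => ((γ a ^ (θ / 2) : ℝ) : ℂ) := by
    funext a
    rw [← suppRpow_of_pos (hγ a), ← suppCpow_ofReal (hγ a).le]
    push_cast
    rfl
  refine le_trans (le_of_eq ?_) hfin
  simp only [F, α, β, ht]
  congr 1
  refine Finset.sum_congr rfl fun k _ => Finset.sum_congr rfl fun j _ =>
    Finset.sum_congr rfl fun m _ => ?_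
  rw [suppCpow_ofReal (hη k j), ← suppCpow_ofReal (hw m)]
  push_cast
  rfl

end Interpolation

/-! ### Duality and the core trace estimate -/

section Bilinear

variable {ι μ K : Type*} [Fintype ι] [DecidableEq ι] [Fintype μ] [DecidableEq μ] [Fintype K]

/-- The matrices whose singular values are `η ^ θ` for some `η` of total mass at most one. For
`θ = 1 / p` this is the unit ball of the Schatten norm of exponent `p`. -/
def schattenBall (ι : Type*) [Fintype ι] [DecidableEq ι] (θ : ℝ) : Set (Matrix ι ι ℂ) :=
  {A | ∃ U ∈ unitary (Matrix ι ι ℂ), ∃ V ∈ unitary (Matrix ι ι ℂ), ∃ η : ι → ℝ,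
    (∀ i, 0 ≤ η i) ∧ ∑ i, η i ≤ 1 ∧ A = U * diagonal (fun i => ((suppRpow (η i) θ : ℝ) : ℂ)) * V}

theorem unitary_mul_mul_mem_schattenBall {θ : ℝ} {A G H : Matrix ι ι ℂ}
    (hA : A ∈ schattenBall ι θ) (hG : G ∈ unitary (Matrix ι ι ℂ))
    (hH : H ∈ unitary (Matrix ι ι ℂ)) : G * A * H ∈ schattenBall ι θ := by
  obtain ⟨U, hU, V, hV, η, hη, hη1, rfl⟩ := hA
  exact ⟨G * U, mul_mem hG hU, V * H, mul_mem hV hH, η, hη, hη1, by simp only [Matrix.mul_assoc]⟩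

theorem mem_schattenBall {p : ℝ} (hp : 1 ≤ p) {A : Matrix ι ι ℂ} (hA : schattenNorm p A ≤ 1) :
    A ∈ schattenBall ι (1 / p) := by
  obtain ⟨U, hU, V, hV, s, hs, rfl⟩ := exists_svd A
  refine ⟨U, hU, V, hV, fun i => s i ^ p, fun i => Real.rpow_nonneg (hs i) _, ?_, ?_⟩
  · rw [← schattenNorm_rpow_svd hU hV hs hp]
    exact Real.rpow_le_one (schattenNorm_nonneg _ _) hA (by linarith)
  · congr 3
    funext i
    rw [suppRpow_of_ne_zero (by positivity), ← Real.rpow_mul (hs i),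
      mul_one_div_cancel (by linarith), Real.rpow_one]

/-- Y is the extremiser in Hölder's inequality, with the singular frames of A reversed and weights
s^p / ∑ s^p. For p = 1 the exponent is 0, and the support convention makes Y a partial isometry. -/
theorem exists_trace_mul_eq_schattenNorm {p : ℝ} (hp : 1 ≤ p) (A : Matrix ι ι ℂ) :
    ∃ Y ∈ schattenBall ι (1 - 1 / p), (A * Y).trace = (schattenNorm p A : ℂ) := by
  obtain ⟨U, hU, V, hV, s, hs, rfl⟩ := exists_svd A
  have hsp : ∀ i, 0 ≤ s i ^ p := fun i => Real.rpow_nonneg (hs i) _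
  have hp0 : 0 < p := by linarith
  set N := ∑ i, s i ^ p with hN
  have hN0 : 0 ≤ N := Finset.sum_nonneg fun i _ => hsp i
  refine ⟨star V * diagonal (fun i => ((suppRpow (s i ^ p / N) (1 - 1 / p) : ℝ) : ℂ)) * star U,
    ⟨star V, Unitary.star_mem hV, star U, Unitary.star_mem hU, fun i => s i ^ p / N,
      fun i => div_nonneg (hsp i) hN0, ?_, rfl⟩, ?_⟩
  · rw [← Finset.sum_div]
    exact div_self_le_one N
  · have h1 : (U * diagonal (fun i => (s i : ℂ)) * V *
        (star V * diagonal (fun i => ((suppRpow (s i ^ p / N) (1 - 1 / p) : ℝ) : ℂ)) * star U)).trace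
        = ((∑ i, s i * suppRpow (s i ^ p / N) (1 - 1 / p) : ℝ) : ℂ) := by
      have h2 : U * diagonal (fun i => (s i : ℂ)) * V *
        (star V * diagonal (fun i => ((suppRpow (s i ^ p / N) (1 - 1 / p) : ℝ) : ℂ)) * star U) =
        U * diagonal (fun i => (s i : ℂ)) * (V * star V) *
          diagonal (fun i => ((suppRpow (s i ^ p / N) (1 - 1 / p) : ℝ) : ℂ)) * star U := by
        simp only [Matrix.mul_assoc]
      rw [h2, (Unitary.mem_iff.mp hV).2, Matrix.mul_one, Matrix.mul_assoc U, diagonal_mul_diagonal,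
        trace_mul_cycle, (Unitary.mem_iff.mp hU).1, Matrix.one_mul, trace_diagonal]
      push_cast
      rfl
    rw [h1, schattenNorm_svd hU hV hs, ← hN]
    congr 1
    -- If N = 0 the quotients s^p / N are 0 by convention, so Y = 0, consistent with A = 0.
    rcases hN0.eq_or_lt with h0 | h0
    · rw [← h0, Real.zero_rpow (by positivity)]
      simp [suppRpow]
    · have h3 : ∀ i, s i * suppRpow (s i ^ p / N) (1 - 1 / p) = s i ^ p / N ^ (1 - 1 / p) := by
        intro i
        rcases (hs i).eq_or_lt with hi | hi
        · rw [← hi, Real.zero_rpow hp0.ne']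
          simp
        · rw [suppRpow_of_pos (by positivity), Real.div_rpow (hsp i) hN0, ← Real.rpow_mul (hs i),
            mul_div_assoc']
          congr 1
          rw [mul_sub, mul_one, mul_one_div_cancel hp0.ne', Real.rpow_sub_one hi.ne']
          field_simp
      simp_rw [h3]
      rw [← Finset.sum_div, ← hN, div_eq_iff (by positivity), ← Real.rpow_add h0]
      simp

theorem exists_spectral {A : Matrix ι ι ℂ} (hA : A.PosSemidef) :
    ∃ G ∈ unitary (Matrix ι ι ℂ), ∃ c : ι → ℝ, (∀ i, 0 ≤ c i) ∧
      A = G * diagonal (fun i => (c i : ℂ)) * star G :=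
  ⟨(hA.1.eigenvectorUnitary : Matrix ι ι ℂ), hA.1.eigenvectorUnitary.2, hA.1.eigenvalues,
    hA.eigenvalues_nonneg, hA.1.spectral_theorem⟩

theorem exists_eq_conjTranspose_mul_self {A : Matrix ι ι ℂ} (hA : A.PosSemidef) :
    ∃ B : Matrix ι ι ℂ, A = Bᴴ * B := by
  obtain ⟨G, -, c, hc, rfl⟩ := exists_spectral hA
  refine ⟨diagonal (fun i => ((Real.sqrt (c i) : ℝ) : ℂ)) * star G, ?_⟩
  have h : (diagonal (fun i => ((Real.sqrt (c i) : ℝ) : ℂ)))ᴴ *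
      diagonal (fun i => ((Real.sqrt (c i) : ℝ) : ℂ)) = diagonal (fun i => (c i : ℂ)) := by
    rw [diagonal_conjTranspose, diagonal_mul_diagonal]
    congr 1
    funext i
    rw [Pi.star_apply, RCLike.star_def, Complex.conj_ofReal, ← Complex.ofReal_mul,
      Real.mul_self_sqrt (hc i)]
  rw [conjTranspose_mul, star_eq_conjTranspose, conjTranspose_conjTranspose, ← h]
  simp only [Matrix.mul_assoc]

theorem sliceCoeff_eq_mul_apply (B : Matrix K ι ℂ) (V : Matrix μ μ ℂ) {ρ : K → ι → ℂ} {t : ι → ℂ}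
    (h : ∀ i a, B i a = ρ i a * t a) (W : Matrix (ι × μ) (ι × μ) ℂ) (i : K) (j : μ) (m : ι × μ) :
    sliceCoeff (ρ i) V t (Wᵀ m) j = ((B ⊗ₖ V) * W) (i, j) m := by
  rw [sliceCoeff, Matrix.mul_apply, Fintype.sum_prod_type_right]
  refine Finset.sum_congr rfl fun b _ => ?_
  rw [Finset.mul_sum]
  refine Finset.sum_congr rfl fun a _ => ?_
  rw [kroneckerMap_apply, h, transpose_apply]
  ring

/-- Puts the trace pairing in the form that is interpolated: singular values and weights t appear as
separate scalars, each of which can be replaced by a complex power. -/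
theorem trace_kronecker_mul_eq [DecidableEq K] (B : Matrix K ι ℂ) (U V : Matrix μ μ ℂ)
    (U' V' : Matrix (ι × μ) (ι × μ) ℂ) (d : μ → ℂ) (d' : ι × μ → ℂ) {ρ : K → ι → ℂ} {t : ι → ℝ}
    (h : ∀ i a, B i a = star (ρ i a) * (t a : ℂ)) :
    (((Bᴴ * B) ⊗ₖ (U * diagonal d * V)) * (U' * diagonal d' * V')).trace =
      ∑ i, ∑ j, ∑ m, d j * d' m *
        (sliceCoeff (fun a => star (ρ i a)) V (fun a => (t a : ℂ)) (U'ᵀ m) j *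
          sliceCoeff (ρ i) Uᵀ (fun a => (t a : ℂ)) (V' m) j) := by
  have h1 : (Bᴴ * B) ⊗ₖ (U * diagonal d * V) =
      (Bᴴ ⊗ₖ U) * diagonal (fun x : K × μ => d x.2) * (B ⊗ₖ V) := by
    have h2 : diagonal (fun x : K × μ => d x.2) = (1 : Matrix K K ℂ) ⊗ₖ diagonal d := by
      rw [← diagonal_one, diagonal_kronecker_diagonal]
      simp
    rw [h2, ← mul_kronecker_mul, ← mul_kronecker_mul, Matrix.mul_one]
  have h3 : (Bᴴ ⊗ₖ U) * diagonal (fun x : K × μ => d x.2) * (B ⊗ₖ V) * (U' * diagonal d' * V') =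
      (Bᴴ ⊗ₖ U) * (diagonal (fun x : K × μ => d x.2) * (((B ⊗ₖ V) * U') * diagonal d' * V')) := by
    simp only [Matrix.mul_assoc]
  have h4 : ∀ i j m, sliceCoeff (ρ i) Uᵀ (fun a => (t a : ℂ)) (V' m) j =
      (V' * (Bᴴ ⊗ₖ U)) m (i, j) := by
    intro i j m
    have := sliceCoeff_eq_mul_apply (B.map star) Uᵀ (ρ := ρ) (t := fun a => (t a : ℂ))
      (fun i a => by simp [h i a]) V'ᵀ i j m
    rw [transpose_transpose] at this
    rw [this]
    have h5 : (B.map star ⊗ₖ Uᵀ) = (Bᴴ ⊗ₖ U)ᵀ := rfl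
    rw [h5, ← transpose_mul, transpose_apply]
  rw [h1, h3, trace_mul_comm, Matrix.trace, Fintype.sum_prod_type]
  refine Finset.sum_congr rfl fun i _ => Finset.sum_congr rfl fun j _ => ?_
  rw [diag_apply, Matrix.mul_assoc, diagonal_mul,
    Matrix.mul_assoc ((B ⊗ₖ V) * U' * diagonal d'), mul_diagonal_mul_apply, Finset.mul_sum]
  refine Finset.sum_congr rfl fun m _ => ?_
  rw [h4, sliceCoeff_eq_mul_apply B V (ρ := fun i a => star (ρ i a)) h]
  ring

theorem norm_sq_sum_mulVec_eq (B : Matrix ι ι ℂ) (y : ι → ℂ) :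
    ∑ i, ‖∑ a, B i a * y a‖ ^ 2 = (star y ⬝ᵥ (Bᴴ * B) *ᵥ y).re := by
  have h2 : ((∑ i, ‖(B *ᵥ y) i‖ ^ 2 : ℝ) : ℂ) = star y ⬝ᵥ (Bᴴ * B) *ᵥ y := by
    rw [← mulVec_mulVec, dotProduct_mulVec, ← star_mulVec]
    push_cast
    refine Finset.sum_congr rfl fun j _ => ?_
    rw [Pi.star_apply, RCLike.star_def, Complex.conj_mul']
  rw [← h2, Complex.ofReal_re]
  rfl

/-- The core estimate when the dominating matrix is diagonal. Positivity of the R k supplies square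
roots, and the operator inequality becomes the Bessel inequality. -/
theorem norm_trace_sum_kronecker_mul_le_of_diagonal {θ : ℝ} (hθ0 : 0 ≤ θ) (hθ1 : θ ≤ 1)
    {γ : ι → ℝ} (hγ : ∀ a, 0 < γ a) {R : K → Matrix ι ι ℂ} (hR : ∀ k, (R k).PosSemidef)
    (hle : (diagonal (fun a => ((γ a ^ θ : ℝ) : ℂ)) - ∑ k, R k).PosSemidef)
    {Y : K → Matrix μ μ ℂ} (hY : ∀ k, Y k ∈ schattenBall μ θ) {W : Matrix (ι × μ) (ι × μ) ℂ}
    (hW : W ∈ schattenBall (ι × μ) (1 - θ)) :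
    ‖((∑ k, R k ⊗ₖ Y k) * W).trace‖ ≤ (∑ a, γ a) ^ θ := by
  choose U hU V hV η hη hη1 hY using hY
  obtain ⟨U', hU', V', hV', w, hw, hw1, rfl⟩ := hW
  choose B hB using fun k => exists_eq_conjTranspose_mul_self (hR k)
  -- The conjugated rows of the factors B k, with R k = (B k)ᴴ * B k, divided by γ^{θ/2}. This
  -- division is why γ must be strictly positive.
  let ρ : K × ι → ι → ℂ := fun x a => star (B x.1 x.2 a) * ((γ a ^ (-(θ / 2)) : ℝ) : ℂ)
  have hpow : ∀ a, γ a ^ (-(θ / 2)) * γ a ^ (θ / 2) = 1 := fun a => by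
    rw [← Real.rpow_add (hγ a)]
    simp
  have hB' : ∀ k i a, B k i a = star (ρ (k, i) a) * ((γ a ^ (θ / 2) : ℝ) : ℂ) := fun k i a => by
    have := hpow a
    simp only [ρ, star_mul', RCLike.star_def, Complex.conj_ofReal, Complex.conj_conj]
    rw [mul_assoc, ← Complex.ofReal_mul, this, Complex.ofReal_one, mul_one]
  -- With y = γ^{-θ/2} x, the sum equals ⟨y, (∑ R k) y⟩ ≤ ⟨y, γ^θ y⟩ = ‖x‖².
  have hρ' : IsBessel fun x a => star (ρ x a) := by
    intro x
    set y : ι → ℂ := fun a => ((γ a ^ (-(θ / 2)) : ℝ) : ℂ) * x a with hy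
    have h1 : ∀ k : K × ι, ∑ a, star (ρ k a) * x a = ∑ a, B k.1 k.2 a * y a := fun k => by
      refine Finset.sum_congr rfl fun a _ => ?_
      simp only [ρ, hy, star_mul', RCLike.star_def, Complex.conj_ofReal,
        Complex.conj_conj]
      ring
    simp_rw [h1]
    rw [Fintype.sum_prod_type]
    simp_rw [norm_sq_sum_mulVec_eq, ← hB]
    have h2 := (Complex.le_def.mp (hle.dotProduct_mulVec_nonneg y)).1
    rw [Matrix.sub_mulVec, dotProduct_sub, Complex.sub_re, Complex.zero_re, sub_nonneg,
      Matrix.sum_mulVec, dotProduct_sum, Complex.re_sum] at h2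
    refine h2.trans (le_of_eq ?_)
    rw [dotProduct, Complex.re_sum]
    refine Finset.sum_congr rfl fun a _ => ?_
    rw [mulVec_diagonal, Pi.star_apply]
    have h3 : star (y a) * (((γ a ^ θ : ℝ) : ℂ) * y a) =
        ((γ a ^ θ * ‖y a‖ ^ 2 : ℝ) : ℂ) := by
      push_cast
      rw [← Complex.conj_mul', RCLike.star_def]
      ring
    rw [h3, Complex.ofReal_re, hy]
    simp only [norm_mul, Complex.norm_real, Real.norm_of_nonneg (Real.rpow_nonneg (hγ a).le _),
      mul_pow]
    rw [← mul_assoc, ← Real.rpow_natCast (γ a ^ (-(θ / 2))), ← Real.rpow_mul (hγ a).le,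
      ← Real.rpow_add (hγ a)]
    have h4 : θ + -(θ / 2) * ((2 : ℕ) : ℝ) = 0 := by push_cast; ring
    rw [h4, Real.rpow_zero, one_mul]
  have hρ : IsBessel ρ := by simpa using hρ'.conj
  have hmain := norm_interpolated_sum_le hθ0 hθ1 hγ hρ (U := fun x => U x.1) (V := fun x => V x.1)
    (fun x => hU x.1) (fun x => hV x.1) (η := fun x => η x.1) (fun x => hη x.1) (fun x => hη1 x.1)
    hU' hV' hw hw1
  refine le_trans (le_of_eq ?_) hmain
  congr 1
  rw [Finset.sum_mul, trace_sum, Fintype.sum_prod_type]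
  refine Finset.sum_congr rfl fun k _ => ?_
  rw [hB k, hY k, trace_kronecker_mul_eq (B k) (U k) (V k) U' V' _ _ (ρ := fun i => ρ (k, i))
    (hB' k)]

/-- Conjugation by G ⊗ 1 reduces to the diagonal case: it leaves the Y k untouched and preserves the
ball containing W. -/
theorem norm_trace_sum_kronecker_mul_le {θ : ℝ} (hθ0 : 0 ≤ θ) (hθ1 : θ ≤ 1)
    {γ : ι → ℝ} (hγ : ∀ a, 0 < γ a) {G : Matrix ι ι ℂ} (hG : G ∈ unitary (Matrix ι ι ℂ))
    {R : K → Matrix ι ι ℂ} (hR : ∀ k, (R k).PosSemidef)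
    (hle : (G * diagonal (fun a => ((γ a ^ θ : ℝ) : ℂ)) * star G - ∑ k, R k).PosSemidef)
    {Y : K → Matrix μ μ ℂ} (hY : ∀ k, Y k ∈ schattenBall μ θ) {W : Matrix (ι × μ) (ι × μ) ℂ}
    (hW : W ∈ schattenBall (ι × μ) (1 - θ)) :
    ‖((∑ k, R k ⊗ₖ Y k) * W).trace‖ ≤ (∑ a, γ a) ^ θ := by
  have hGG := Unitary.mem_iff.mp hG
  set H : Matrix (ι × μ) (ι × μ) ℂ := G ⊗ₖ (1 : Matrix μ μ ℂ) with hH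
  have hHm : H ∈ unitary (Matrix (ι × μ) (ι × μ) ℂ) := kronecker_mem_unitary hG (one_mem _)
  have hHs : star H = star G ⊗ₖ (1 : Matrix μ μ ℂ) := by
    rw [hH, star_eq_conjTranspose, conjTranspose_kronecker, conjTranspose_one,
      star_eq_conjTranspose]
  have h := norm_trace_sum_kronecker_mul_le_of_diagonal hθ0 hθ1 hγ
    (R := fun k => star G * R k * G) (Y := Y) (W := star H * W * H)
    (fun k => by
      rw [star_eq_conjTranspose]
      exact (hR k).conjTranspose_mul_mul_same G)
    (by
      have h1 := hle.conjTranspose_mul_mul_same G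
      rw [Matrix.mul_sub, Matrix.sub_mul, ← star_eq_conjTranspose] at h1
      have h2 : star G * (G * diagonal (fun a => ((γ a ^ θ : ℝ) : ℂ)) * star G) * G =
          (star G * G) * diagonal (fun a => ((γ a ^ θ : ℝ) : ℂ)) * (star G * G) := by
        simp only [Matrix.mul_assoc]
      rw [h2, hGG.1, Matrix.one_mul, Matrix.mul_one, Finset.mul_sum, Finset.sum_mul] at h1
      exact h1)
    hY (unitary_mul_mul_mem_schattenBall hW (Unitary.star_mem hHm) hHm)
  refine le_trans (le_of_eq ?_) h
  congr 1
  have h3 : ∑ k, (star G * R k * G) ⊗ₖ Y k = star H * (∑ k, R k ⊗ₖ Y k) * H := by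
    rw [Finset.mul_sum, Finset.sum_mul]
    refine Finset.sum_congr rfl fun k _ => ?_
    rw [hHs, hH, ← mul_kronecker_mul, ← mul_kronecker_mul, Matrix.one_mul, Matrix.mul_one]
  have h4 : star H * (∑ k, R k ⊗ₖ Y k) * H * (star H * W * H) =
      star H * ((∑ k, R k ⊗ₖ Y k) * ((H * star H) * W * H)) := by
    simp only [Matrix.mul_assoc]
  rw [h3, h4, (Unitary.mem_iff.mp hHm).2, Matrix.one_mul, trace_mul_comm (star H),
    Matrix.mul_assoc, Matrix.mul_assoc W, (Unitary.mem_iff.mp hHm).2, Matrix.mul_one]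

end Bilinear

/-! ### Norm of ∑ R k ⊗ Y k and its dual form -/

section KroneckerSums

variable {ι μ K : Type*} [Fintype ι] [DecidableEq ι] [Fintype μ] [DecidableEq μ] [Fintype K]

theorem posSemidef_unitary_diagonal {G : Matrix ι ι ℂ} {c : ι → ℝ} (hc : ∀ i, 0 ≤ c i) :
    (G * diagonal (fun i => (c i : ℂ)) * star G).PosSemidef := by
  have h : (diagonal (fun i => (c i : ℂ))).PosSemidef :=
    PosSemidef.diagonal fun i => by simpa using hc i
  rw [star_eq_conjTranspose]
  exact h.mul_mul_conjTranspose_same G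

theorem posSemidef_unitary_diagonal_sub {G : Matrix ι ι ℂ} {c d : ι → ℝ} (hc : ∀ i, c i ≤ d i) :
    (G * diagonal (fun i => (d i : ℂ)) * star G -
      G * diagonal (fun i => (c i : ℂ)) * star G).PosSemidef := by
  have h : G * diagonal (fun i => (d i : ℂ)) * star G - G * diagonal (fun i => (c i : ℂ)) * star G =
      G * diagonal (fun i => ((d i - c i : ℝ) : ℂ)) * star G := by
    rw [← Matrix.sub_mul, ← Matrix.mul_sub, diagonal_sub]
    push_cast
    rfl
  rw [h]
  exact posSemidef_unitary_diagonal fun i => sub_nonneg.mpr (hc i)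

/-- `‖∑ k, R k ⊗ Y k‖_p ≤ ‖∑ k, R k‖_p` if the `R k` are positive and the `Y k` contractions for
the Schatten norm of exponent `p`. -/
theorem schattenNorm_sum_kronecker_le {p : ℝ} (hp : 1 ≤ p) {R : K → Matrix ι ι ℂ}
    (hR : ∀ k, (R k).PosSemidef) {Y : K → Matrix μ μ ℂ} (hY : ∀ k, schattenNorm p (Y k) ≤ 1) :
    schattenNorm p (∑ k, R k ⊗ₖ Y k) ≤ schattenNorm p (∑ k, R k) := by
  have hp0 : 0 < p := by linarith
  obtain ⟨G, hG, c, hc, hC⟩ := exists_spectral (posSemidef_sum Finset.univ fun k _ => hR k)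
  rw [hC, schattenNorm_svd hG (Unitary.star_mem hG) hc]
  obtain ⟨W, hW, hTW⟩ := exists_trace_mul_eq_schattenNorm hp (∑ k, R k ⊗ₖ Y k)
  -- The eigenvalues c of ∑ R k may vanish, so the core estimate is applied with c + ε, and then ε
  -- tends to 0.
  have hε : ∀ ε : ℝ, 0 < ε →
      schattenNorm p (∑ k, R k ⊗ₖ Y k) ≤ (∑ a, (c a + ε) ^ p) ^ (1 / p) := by
    intro ε hε
    have hcε : ∀ a, 0 < c a + ε := fun a => by linarith [hc a]
    have hγ : ∀ a, ((c a + ε) ^ p) ^ (1 / p) = c a + ε := fun a => by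
      rw [← Real.rpow_mul (hcε a).le, mul_one_div_cancel hp0.ne', Real.rpow_one]
    have h := norm_trace_sum_kronecker_mul_le (θ := 1 / p) (by positivity)
      (by rw [div_le_one hp0]; exact hp) (γ := fun a => (c a + ε) ^ p)
      (fun a => Real.rpow_pos_of_pos (hcε a) _) hG hR
      (by
        simp_rw [hγ]
        rw [hC]
        exact posSemidef_unitary_diagonal_sub fun a => by linarith)
      (fun k => mem_schattenBall hp (hY k)) hW
    rwa [hTW, Complex.norm_real, Real.norm_of_nonneg (schattenNorm_nonneg _ _)] at h
  have hcont : Continuous fun ε : ℝ => (∑ a, (c a + ε) ^ p) ^ (1 / p) :=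
    (continuous_finsetSum _ fun a _ => (continuous_const.add continuous_id).rpow_const
      fun _ => Or.inr hp0.le).rpow_const fun _ => Or.inr (by positivity)
  have hlim := (hcont.tendsto 0).mono_left (nhdsWithin_le_nhds (s := Set.Ioi 0))
  simp only [add_zero] at hlim
  exact ge_of_tendsto hlim (by filter_upwards [self_mem_nhdsWithin] with ε h using hε ε h)

theorem trace_unitary_diagonal_mul {G : Matrix ι ι ℂ} (hG : G ∈ unitary (Matrix ι ι ℂ))
    (c d : ι → ℝ) :
    ((G * diagonal (fun i => (c i : ℂ)) * star G) *
      (G * diagonal (fun i => (d i : ℂ)) * star G)).trace = ((∑ i, c i * d i : ℝ) : ℂ) := by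
  have h : (G * diagonal (fun i => (c i : ℂ)) * star G) *
      (G * diagonal (fun i => (d i : ℂ)) * star G) =
      G * diagonal (fun i => (c i : ℂ)) * (star G * G) * diagonal (fun i => (d i : ℂ)) * star G := by
    simp only [Matrix.mul_assoc]
  rw [h, (Unitary.mem_iff.mp hG).1, Matrix.mul_one, Matrix.mul_assoc G, diagonal_mul_diagonal,
    trace_mul_cycle, (Unitary.mem_iff.mp hG).1, Matrix.one_mul, trace_diagonal]
  push_cast
  rfl

/-- The endpoint q = 1, where θ = 0 and the size of ∑ R k cannot be stored in γ^θ. Instead the R k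
are rescaled to have sum at most 1, and γ = 1. -/
theorem norm_trace_sum_kronecker_mul_le_of_one {R : K → Matrix ι ι ℂ}
    (hR : ∀ k, (R k).PosSemidef) {M : ℝ} (hM0 : 0 ≤ M)
    (hM : ∀ B : Matrix ι ι ℂ, B.PosSemidef →
      ((∑ k, R k) * B).trace.re ≤ M * schattenNorm 1 B)
    {Y : K → Matrix μ μ ℂ} (hY : ∀ k, Y k ∈ schattenBall μ 0) {A : Matrix (ι × μ) (ι × μ) ℂ}
    (hA : A ∈ schattenBall (ι × μ) 1) {ε : ℝ} (hε : 0 < ε) :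
    ‖((∑ k, R k ⊗ₖ Y k) * A).trace‖ ≤ M + ε := by
  obtain ⟨G, hG, c, hc, hC⟩ := exists_spectral (posSemidef_sum Finset.univ fun k _ => hR k)
  -- Testing against the rank-one spectral projections, of trace norm 1, shows that M bounds every
  -- eigenvalue.
  have hcM : ∀ a, c a ≤ M := fun a => by
    have h0 : ∀ i, (0 : ℝ) ≤ (Pi.single a 1 : ι → ℝ) i := fun i => by
      by_cases h : i = a
      · subst h; simp
      · simp [h]
    have h := hM _ (posSemidef_unitary_diagonal (G := G) h0)
    rw [hC, trace_unitary_diagonal_mul hG, schattenNorm_svd hG (Unitary.star_mem hG) h0,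
      Complex.ofReal_re] at h
    simpa [Pi.single_apply] using h
  have hMε : 0 < M + ε := by linarith
  have h := norm_trace_sum_kronecker_mul_le (θ := 0) le_rfl zero_le_one (γ := fun _ : ι => 1)
    (fun _ => one_pos) hG (R := fun k => (((M + ε)⁻¹ : ℝ) : ℂ) • R k)
    (fun k => (hR k).smul (by
      rw [Complex.zero_le_real]
      positivity))
    (by
      have h1 : ∑ k, (((M + ε)⁻¹ : ℝ) : ℂ) • R k =
          G * diagonal (fun i => (((M + ε)⁻¹ * c i : ℝ) : ℂ)) * star G := by
        rw [← Finset.smul_sum, hC, ← Matrix.smul_mul, ← Matrix.mul_smul, ← diagonal_smul]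
        congr 3
        funext i
        simp
      rw [h1]
      refine posSemidef_unitary_diagonal_sub fun i => ?_
      rw [Real.rpow_zero, inv_mul_le_one₀ hMε]
      linarith [hcM i])
    hY (by rwa [sub_zero])
  rw [Real.rpow_zero] at h
  have h2 : ∑ k, ((((M + ε)⁻¹ : ℝ) : ℂ) • R k) ⊗ₖ Y k =
      (((M + ε)⁻¹ : ℝ) : ℂ) • ∑ k, R k ⊗ₖ Y k := by
    rw [Finset.smul_sum]
    simp_rw [smul_kronecker]
  rw [h2, Matrix.smul_mul, trace_smul, norm_smul, Complex.norm_real,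
    Real.norm_of_nonneg (by positivity), inv_mul_le_one₀ hMε] at h
  exact h

theorem norm_trace_sum_kronecker_mul_le_of_one_lt {q : ℝ} (hq : 1 < q) {R : K → Matrix ι ι ℂ}
    (hR : ∀ k, (R k).PosSemidef) {M : ℝ} (hM0 : 0 ≤ M)
    (hM : ∀ B : Matrix ι ι ℂ, B.PosSemidef →
      ((∑ k, R k) * B).trace.re ≤ M * schattenNorm q B)
    {Y : K → Matrix μ μ ℂ} (hY : ∀ k, Y k ∈ schattenBall μ (1 - 1 / q))
    {A : Matrix (ι × μ) (ι × μ) ℂ} (hA : A ∈ schattenBall (ι × μ) (1 / q)) {ε : ℝ} (hε : 0 < ε) :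
    ‖((∑ k, R k ⊗ₖ Y k) * A).trace‖ ≤ M + Fintype.card ι * ε := by
  have hq0 : 0 < q := by linarith
  obtain ⟨G, hG, c, hc, hC⟩ := exists_spectral (posSemidef_sum Finset.univ fun k _ => hR k)
  set θ : ℝ := 1 - 1 / q with hθ
  have hθ0 : 0 < θ := by
    rw [hθ, sub_pos, div_lt_one hq0]
    exact hq
  have hθq : (1 - θ) * q = 1 := by
    rw [hθ]
    field_simp
    ring
  have hcε : ∀ a, 0 < c a + ε := fun a => by linarith [hc a]
  -- Since 1/θ is the exponent conjugate to q, the bound (∑ γ)^θ is the dual norm of the perturbed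
  -- sum.
  set γ : ι → ℝ := fun a => (c a + ε) ^ (1 / θ) with hγdef
  have hγ0 : ∀ a, 0 < γ a := fun a => Real.rpow_pos_of_pos (hcε a) _
  have hγ : ∀ a, γ a ^ θ = c a + ε := fun a => by
    rw [hγdef, ← Real.rpow_mul (hcε a).le, one_div_mul_cancel hθ0.ne', Real.rpow_one]
  have h := norm_trace_sum_kronecker_mul_le hθ0.le (by rw [hθ]; linarith [one_div_pos.mpr hq0])
    hγ0 hG hR
    (by
      simp_rw [hγ]
      rw [hC]
      exact posSemidef_unitary_diagonal_sub fun a => by linarith)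
    hY (by rw [hθ, sub_sub_cancel]; exact hA)
  refine h.trans ?_
  set S := ∑ a, γ a with hS
  have hS0 : 0 ≤ S := Finset.sum_nonneg fun a _ => (hγ0 a).le
  rcases hS0.eq_or_lt with h0 | hSpos
  · rw [← h0, Real.zero_rpow hθ0.ne']
    positivity
  have hγ' : ∀ a, 0 ≤ γ a ^ (1 - θ) := fun a => Real.rpow_nonneg (hγ0 a).le _
  -- B has eigenvalues γ^{1-θ}, the Hölder extremiser for c + ε, and ‖B‖_q = S^{1-θ} because (1-θ)q
  -- = 1. Thus testing against positive B alone controls S.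
  have hB := hM _ (posSemidef_unitary_diagonal (G := G) hγ')
  rw [hC, trace_unitary_diagonal_mul hG, Complex.ofReal_re,
    schattenNorm_svd hG (Unitary.star_mem hG) hγ'] at hB
  simp_rw [← Real.rpow_mul (hγ0 _).le, hθq, Real.rpow_one] at hB
  have h1q : 1 / q = 1 - θ := by rw [hθ]; ring
  rw [← hS, h1q] at hB
  have hle : ∀ a, γ a ^ (1 - θ) ≤ S ^ (1 - θ) := fun a =>
    Real.rpow_le_rpow (hγ0 a).le
      (Finset.single_le_sum (fun b _ => (hγ0 b).le) (Finset.mem_univ a))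
      (by rw [← h1q]; positivity)
  -- Split γ = (c + ε) γ^{1-θ}: the c part is bounded by the test against B, and each of the `card
  -- ι` terms with ε is at most ε S^{1-θ}.
  have hsum : S ≤ (M + Fintype.card ι * ε) * S ^ (1 - θ) := by
    have h2 : S = ∑ a, c a * γ a ^ (1 - θ) + ε * ∑ a, γ a ^ (1 - θ) := by
      rw [Finset.mul_sum, ← Finset.sum_add_distrib]
      refine Finset.sum_congr rfl fun a _ => ?_
      rw [← add_mul, ← hγ a, ← Real.rpow_add (hγ0 a)]
      simp
    have h3 : ∑ a, γ a ^ (1 - θ) ≤ Fintype.card ι * S ^ (1 - θ) := by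
      refine (Finset.sum_le_sum fun a _ => hle a).trans (le_of_eq ?_)
      rw [Finset.sum_const, Finset.card_univ, nsmul_eq_mul]
    have h4 := mul_le_mul_of_nonneg_left h3 hε.le
    linarith
  have hS1 : 0 < S ^ (1 - θ) := Real.rpow_pos_of_pos hSpos _
  have h5 : S ^ θ * S ^ (1 - θ) = S := by
    rw [← Real.rpow_add hSpos]
    simp
  exact le_of_mul_le_mul_right (h5.le.trans hsum) hS1

theorem norm_trace_sum_kronecker_mul_le_mul_schattenNorm {q : ℝ} (hq : 1 ≤ q)
    {R : K → Matrix ι ι ℂ} (hR : ∀ k, (R k).PosSemidef) {M : ℝ} (hM0 : 0 ≤ M)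
    (hM : ∀ B : Matrix ι ι ℂ, B.PosSemidef →
      ((∑ k, R k) * B).trace.re ≤ M * schattenNorm q B)
    {Y : K → Matrix μ μ ℂ} (hY : ∀ k, Y k ∈ schattenBall μ (1 - 1 / q))
    (A : Matrix (ι × μ) (ι × μ) ℂ) :
    ‖((∑ k, R k ⊗ₖ Y k) * A).trace‖ ≤ M * schattenNorm q A := by
  have hball : ∀ A ∈ schattenBall (ι × μ) (1 / q), ‖((∑ k, R k ⊗ₖ Y k) * A).trace‖ ≤ M := by
    intro A hA
    rcases hq.eq_or_lt with h1 | h1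
    · subst h1
      refine le_of_forall_pos_le_add fun ε hε => ?_
      exact norm_trace_sum_kronecker_mul_le_of_one hR hM0 hM (by simpa using hY)
        (by simpa using hA) hε
    · refine le_of_forall_pos_le_add fun ε hε => ?_
      have hn : (0 : ℝ) < Fintype.card ι + 1 := by positivity
      refine (norm_trace_sum_kronecker_mul_le_of_one_lt h1 hR hM0 hM hY hA
        (div_pos hε hn)).trans ?_
      have : (Fintype.card ι : ℝ) * (ε / (Fintype.card ι + 1)) ≤ ε := by
        rw [mul_div_assoc', div_le_iff₀ hn]
        nlinarith
      linarith
  by_cases hA : A = 0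
  · simp [hA, schattenNorm_zero hq]
  have hN := schattenNorm_pos hq hA
  have h := hball ((((schattenNorm q A)⁻¹ : ℝ) : ℂ) • A) (mem_schattenBall hq (by
    rw [schattenNorm_smul hq (by positivity), inv_mul_cancel₀ hN.ne']))
  rwa [Matrix.mul_smul, trace_smul, norm_smul, Complex.norm_real,
    Real.norm_of_nonneg (by positivity), inv_mul_le_iff₀ hN, mul_comm] at h

end KroneckerSums

/-! ### Map norms, partial traces and measure-and-prepare maps -/

section MapNorm

variable {ι κ μ ν : Type*} [Fintype ι] [DecidableEq ι] [Fintype κ] [DecidableEq κ]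
  [Fintype μ] [DecidableEq μ] [Fintype ν] [DecidableEq ν]

theorem mapNorm_le_ofReal {q p N : ℝ} (hq : 1 ≤ q) {L : Matrix ι ι ℂ →ₗ[ℂ] Matrix κ κ ℂ}
    (h : ∀ A, schattenNorm p (L A) ≤ N * schattenNorm q A) :
    mapNorm q p L ≤ ENNReal.ofReal N := by
  refine iSup₂_le fun A hA => ?_
  have hpos := schattenNorm_pos hq hA
  rw [← ENNReal.ofReal_div_of_pos hpos]
  exact ENNReal.ofReal_le_ofReal ((div_le_iff₀ hpos).mpr (h A))

theorem linearMap_apply_eq_sum (L : Matrix ι ι ℂ →ₗ[ℂ] Matrix κ κ ℂ) (A : Matrix ι ι ℂ) :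
    L A = ∑ i, ∑ j, A i j • L (Matrix.single i j 1) := by
  conv_lhs => rw [Matrix.matrix_eq_sum_single A]
  simp only [map_sum, ← map_smul, Matrix.smul_single, smul_eq_mul, mul_one]

/-- Finiteness allows `toReal` to be used and nonzero map norms to be cancelled in quotients. -/
theorem mapNorm_ne_top {q p : ℝ} (hq : 1 ≤ q) (hp : 1 ≤ p)
    (L : Matrix ι ι ℂ →ₗ[ℂ] Matrix κ κ ℂ) : mapNorm q p L ≠ ⊤ := by
  refine ne_top_of_le_ne_top ENNReal.ofReal_ne_top (mapNorm_le_ofReal (N :=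
    (Fintype.card κ : ℝ) ^ (1 / p) * ∑ a, ∑ b, ∑ i, ∑ j, ‖L (Matrix.single i j 1) a b‖) hq
    fun A => ?_)
  refine (schattenNorm_le_sum_norm hp _).trans ?_
  rw [mul_assoc]
  refine mul_le_mul_of_nonneg_left ?_ (by positivity)
  rw [Finset.sum_mul]
  refine Finset.sum_le_sum fun a _ => ?_
  rw [Finset.sum_mul]
  refine Finset.sum_le_sum fun b _ => ?_
  rw [linearMap_apply_eq_sum, Matrix.sum_apply, Finset.sum_mul]
  refine (norm_sum_le _ _).trans (Finset.sum_le_sum fun i _ => ?_)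
  rw [Matrix.sum_apply, Finset.sum_mul]
  refine (norm_sum_le _ _).trans (Finset.sum_le_sum fun j _ => ?_)
  rw [Matrix.smul_apply, norm_smul, mul_comm]
  exact mul_le_mul_of_nonneg_left (norm_apply_le_schattenNorm hq A i j) (norm_nonneg _)

theorem schattenNorm_apply_le {q p : ℝ} (hq : 1 ≤ q) (hp : 1 ≤ p)
    (L : Matrix ι ι ℂ →ₗ[ℂ] Matrix κ κ ℂ) (A : Matrix ι ι ℂ) :
    schattenNorm p (L A) ≤ (mapNorm q p L).toReal * schattenNorm q A := by
  by_cases hA : A = 0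
  · simp [hA, schattenNorm_zero hq, schattenNorm_zero hp]
  have hpos := schattenNorm_pos hq hA
  have h : ENNReal.ofReal (schattenNorm p (L A)) / ENNReal.ofReal (schattenNorm q A) ≤
      mapNorm q p L :=
    le_iSup₂ (f := fun (A : Matrix ι ι ℂ) (_ : A ≠ 0) =>
      ENNReal.ofReal (schattenNorm p (L A)) / ENNReal.ofReal (schattenNorm q A)) A hA
  rw [← ENNReal.ofReal_div_of_pos hpos,
    ENNReal.ofReal_le_iff_le_toReal (mapNorm_ne_top hq hp L), div_le_iff₀ hpos] at h
  exact h

theorem mapNorm_ne_zero {q p : ℝ} (hq : 1 ≤ q) (hp : 1 ≤ p)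
    {L : Matrix ι ι ℂ →ₗ[ℂ] Matrix κ κ ℂ} (hL : L ≠ 0) : mapNorm q p L ≠ 0 := by
  intro h
  refine hL (LinearMap.ext fun A => schattenNorm_eq_zero hp
    (le_antisymm ?_ (schattenNorm_nonneg _ _)))
  simpa [h] using schattenNorm_apply_le hq hp L A

theorem mapNorm_mul_le_mapNorm_tensorMap {q p : ℝ} (hq : 1 ≤ q)
    (L : Matrix ι ι ℂ →ₗ[ℂ] Matrix κ κ ℂ) (M : Matrix μ μ ℂ →ₗ[ℂ] Matrix ν ν ℂ) :
    mapNorm q p L * mapNorm q p M ≤ mapNorm q p (tensorMap L M) := by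
  rw [mapNorm, mapNorm]
  simp_rw [ENNReal.iSup_mul, ENNReal.mul_iSup]
  refine iSup₂_le fun A hA => iSup₂_le fun B hB => ?_
  have hAB : A ⊗ₖ B ≠ 0 := fun h => by
    have h1 := schattenNorm_kronecker (p := q) A B
    rw [h, schattenNorm_zero hq] at h1
    exact (mul_pos (schattenNorm_pos hq hA) (schattenNorm_pos hq hB)).ne h1
  refine le_trans (le_of_eq ?_) (le_iSup₂ (f := fun (A : Matrix (ι × μ) (ι × μ) ℂ) (_ : A ≠ 0) =>
    ENNReal.ofReal (schattenNorm p (tensorMap L M A)) / ENNReal.ofReal (schattenNorm q A))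
    (A ⊗ₖ B) hAB)
  have hA' := schattenNorm_pos hq hA
  have hB' := schattenNorm_pos hq hB
  rw [tensorMap_kronecker, schattenNorm_kronecker, schattenNorm_kronecker,
    ← ENNReal.ofReal_div_of_pos hA', ← ENNReal.ofReal_div_of_pos hB',
    ← ENNReal.ofReal_div_of_pos (mul_pos hA' hB'),
    ← ENNReal.ofReal_mul (div_nonneg (schattenNorm_nonneg _ _) hA'.le), div_mul_div_comm]

/-- The partial trace `Tr₁ ((X ⊗ 1) A)`. -/
def weightedPartialTrace (X : Matrix ι ι ℂ) (A : Matrix (ι × μ) (ι × μ) ℂ) : Matrix μ μ ℂ :=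
  Matrix.of fun b b' => ∑ a, ∑ a', X a' a * A (a, b) (a', b')

theorem tensorMap_measurePrepare {σ : Type*} [Fintype σ] (X : σ → Matrix ι ι ℂ)
    (R : σ → Matrix κ κ ℂ) (L : Matrix μ μ ℂ →ₗ[ℂ] Matrix ν ν ℂ)
    (A : Matrix (ι × μ) (ι × μ) ℂ) :
    tensorMap (measurePrepare X R) L A = ∑ k, R k ⊗ₖ L (weightedPartialTrace (X k) A) := by
  have h : ∀ s, L (weightedPartialTrace (X s) A) =
      ∑ i, ∑ j, ∑ k, ∑ l, (X s j i * A (i, k) (j, l)) • L (Matrix.single k l 1) := fun s => by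
    rw [linearMap_apply_eq_sum]
    simp only [weightedPartialTrace, Matrix.of_apply, Finset.sum_smul]
    calc _ = ∑ k, ∑ i, ∑ j, ∑ l, (X s j i * A (i, k) (j, l)) • L (Matrix.single k l 1) := by
          refine Finset.sum_congr rfl fun k _ => ?_
          rw [Finset.sum_comm]
          refine Finset.sum_congr rfl fun i _ => ?_
          rw [Finset.sum_comm]
      _ = _ := by
          rw [Finset.sum_comm]
          refine Finset.sum_congr rfl fun i _ => ?_
          rw [Finset.sum_comm]
  have htr : ∀ s i j, (X s * Matrix.single i j 1).trace = X s j i := fun s i j => by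
    simp [Matrix.trace_mul_single]
  ext ⟨a, c⟩ ⟨a', c'⟩
  simp only [h, tensorMap, measurePrepare, LinearMap.coe_mk, AddHom.coe_mk, htr,
    Matrix.sum_apply, Matrix.smul_apply, kroneckerMap_apply, smul_eq_mul, Finset.mul_sum,
    Finset.sum_mul]
  symm
  rw [Finset.sum_comm]
  refine Finset.sum_congr rfl fun i _ => ?_
  rw [Finset.sum_comm]
  refine Finset.sum_congr rfl fun j _ => ?_
  rw [Finset.sum_comm]
  refine Finset.sum_congr rfl fun k _ => ?_
  rw [Finset.sum_comm]
  refine Finset.sum_congr rfl fun l _ => Finset.sum_congr rfl fun s _ => ?_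
  ring

/-- The adjoint relation between tensoring with X and the weighted partial trace; it transfers the
pairing of Z_k with Y_k to a pairing with A. -/
theorem trace_kronecker_mul (X : Matrix ι ι ℂ) (Y : Matrix μ μ ℂ)
    (A : Matrix (ι × μ) (ι × μ) ℂ) :
    ((X ⊗ₖ Y) * A).trace = (weightedPartialTrace X A * Y).trace := by
  rw [trace_mul_comm, Matrix.trace, Matrix.trace, Fintype.sum_prod_type, Finset.sum_comm]
  refine Finset.sum_congr rfl fun b _ => ?_
  simp only [diag_apply, Matrix.mul_apply, weightedPartialTrace, Matrix.of_apply,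
    kroneckerMap_apply, Fintype.sum_prod_type_right, Finset.sum_mul]
  rw [Finset.sum_comm]
  refine Finset.sum_congr rfl fun b' _ => Finset.sum_congr rfl fun a _ =>
    Finset.sum_congr rfl fun a' _ => ?_
  ring

theorem ketBra_apply (v : EuclideanSpace ℂ ι) (i j : ι) : ketBra v i j = v i * star (v j) := rfl

theorem sum_smul_ketBra (b : OrthonormalBasis ι ℂ (EuclideanSpace ℂ ι)) (c : ι → ℂ) :
    ∑ k, c k • ketBra (b k) = basisMatrix b * diagonal c * star (basisMatrix b) := by
  ext i j
  rw [mul_diagonal_mul_apply, Matrix.sum_apply]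
  refine Finset.sum_congr rfl fun k _ => ?_
  rw [Matrix.smul_apply, ketBra_apply, Matrix.star_apply, smul_eq_mul, basisMatrix,
    Matrix.of_apply, Matrix.of_apply]
  ring

theorem ketBra_eq (b : OrthonormalBasis ι ℂ (EuclideanSpace ℂ ι)) (k : ι) :
    ketBra (b k) = basisMatrix b * diagonal (fun i => (((Pi.single k 1 : ι → ℝ) i : ℝ) : ℂ)) *
      star (basisMatrix b) := by
  rw [← sum_smul_ketBra, Finset.sum_eq_single k]
  · simp
  · intro i _ hi
    simp [hi]
  · simp

theorem kronecker_one_mem_unitary {U : Matrix ι ι ℂ} (hU : U ∈ unitary (Matrix ι ι ℂ)) :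
    U ⊗ₖ (1 : Matrix μ μ ℂ) ∈ unitary (Matrix (ι × μ) (ι × μ) ℂ) :=
  kronecker_mem_unitary hU (one_mem _)

theorem weightedPartialTrace_ketBra (b : OrthonormalBasis ι ℂ (EuclideanSpace ℂ ι)) (k : ι)
    (A : Matrix (ι × μ) (ι × μ) ℂ) :
    weightedPartialTrace (ketBra (b k)) A =
      blockAt (star (basisMatrix b ⊗ₖ (1 : Matrix μ μ ℂ)) * A *
        (basisMatrix b ⊗ₖ (1 : Matrix μ μ ℂ))) k := by
  ext j j'
  simp only [weightedPartialTrace, blockAt, Matrix.of_apply, Matrix.mul_apply, Matrix.star_apply,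
    kroneckerMap_apply, Fintype.sum_prod_type, ketBra_apply, basisMatrix, Matrix.one_apply,
    mul_ite, mul_one, mul_zero, apply_ite star, star_zero, ite_mul, zero_mul,
    Finset.sum_ite_eq', Finset.mem_univ, if_true, Finset.sum_mul]
  rw [Finset.sum_comm]
  refine Finset.sum_congr rfl fun a _ => Finset.sum_congr rfl fun a' _ => ?_
  ring

theorem sum_ketBra_kronecker (b : OrthonormalBasis ι ℂ (EuclideanSpace ℂ ι))
    (Z : ι → Matrix μ μ ℂ) :
    ∑ k, ketBra (b k) ⊗ₖ Z k = (basisMatrix b ⊗ₖ (1 : Matrix μ μ ℂ)) * diagBlocks Z *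
      star (basisMatrix b ⊗ₖ (1 : Matrix μ μ ℂ)) := by
  ext ⟨a, j⟩ ⟨a', j'⟩
  simp only [diagBlocks, Matrix.of_apply, Matrix.mul_apply, Matrix.star_apply, Matrix.sum_apply,
    kroneckerMap_apply, Fintype.sum_prod_type, ketBra_apply, basisMatrix, Matrix.one_apply,
    mul_ite, mul_one, mul_zero, apply_ite star, star_zero, ite_mul, zero_mul,
    Finset.sum_ite_eq, Finset.sum_ite_eq', Finset.sum_ite_irrel, Finset.sum_const_zero, Finset.mem_univ, if_true]
  refine Finset.sum_congr rfl fun k _ => ?_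
  ring

end MapNorm

/-! ### Multiplicativity for CQ and QC maps -/

section Multiplicativity

variable {ι κ μ ν : Type*} [Fintype ι] [DecidableEq ι] [Fintype κ] [DecidableEq κ]
  [Fintype μ] [DecidableEq μ] [Fintype ν] [DecidableEq ν]

theorem schattenNorm_le_of_rpow_le {p x : ℝ} (hp : 1 ≤ p) (hx : 0 ≤ x) {A : Matrix ι ι ℂ}
    (h : schattenNorm p A ^ p ≤ x ^ p) : schattenNorm p A ≤ x :=
  (Real.rpow_le_rpow_iff (schattenNorm_nonneg _ _) hx (by linarith)).mp h

theorem schattenNorm_sum_smul_ketBra_rpow {p : ℝ} (hp : 1 ≤ p)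
    (b : OrthonormalBasis ι ℂ (EuclideanSpace ℂ ι)) {x : ι → ℝ} (hx : ∀ k, 0 ≤ x k) :
    schattenNorm p (∑ k, (x k : ℂ) • ketBra (b k)) ^ p = ∑ k, x k ^ p := by
  rw [sum_smul_ketBra, schattenNorm_rpow_svd (basisMatrix_mem b)
    (Unitary.star_mem (basisMatrix_mem b)) hx hp]

/-- Scale invariance: the bound y k moves from the second tensor factor to R k. Where y k = 0 its
inverse is 0 by convention, which is harmless since then Y k = 0. -/
theorem schattenNorm_sum_kronecker_le_sum_smul {K : Type*} [Fintype K] {p : ℝ} (hp : 1 ≤ p)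
    {R : K → Matrix ι ι ℂ} (hR : ∀ k, (R k).PosSemidef) {Y : K → Matrix μ μ ℂ} {y : K → ℝ}
    (hY : ∀ k, schattenNorm p (Y k) ≤ y k) :
    schattenNorm p (∑ k, R k ⊗ₖ Y k) ≤ schattenNorm p (∑ k, (y k : ℂ) • R k) := by
  have hy : ∀ k, 0 ≤ y k := fun k => (schattenNorm_nonneg _ _).trans (hY k)
  have h := schattenNorm_sum_kronecker_le hp (R := fun k => (y k : ℂ) • R k)
    (Y := fun k => (((y k)⁻¹ : ℝ) : ℂ) • Y k)
    (fun k => (hR k).smul (Complex.zero_le_real.mpr (hy k)))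
    (fun k => by
      rw [schattenNorm_smul hp (inv_nonneg.mpr (hy k))]
      exact inv_mul_le_one_of_le₀ (hY k) (hy k))
  refine le_trans (le_of_eq ?_) h
  congr 1
  refine Finset.sum_congr rfl fun k _ => ?_
  rw [smul_kronecker, kronecker_smul, smul_smul]
  by_cases h0 : y k = 0
  · have : Y k = 0 := schattenNorm_eq_zero hp
      (le_antisymm ((hY k).trans h0.le) (schattenNorm_nonneg _ _))
    simp [this]
  · rw [← Complex.ofReal_mul, mul_inv_cancel₀ h0, Complex.ofReal_one, one_smul]

theorem schattenNorm_tensorMap_le_of_isCQ {q p : ℝ} (hq : 1 ≤ q) (hp : 1 ≤ p)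
    {Φ : Matrix ι ι ℂ →ₗ[ℂ] Matrix κ κ ℂ} (hΦ : IsCQ Φ)
    (L : Matrix μ μ ℂ →ₗ[ℂ] Matrix ν ν ℂ) (A : Matrix (ι × μ) (ι × μ) ℂ) :
    schattenNorm p (tensorMap Φ L A) ≤
      (mapNorm q p Φ).toReal * (mapNorm q p L).toReal * schattenNorm q A := by
  obtain ⟨b, R, hR, rfl⟩ := hΦ
  set Φ := measurePrepare (fun k => ketBra (b k)) R with hΦ
  set H : Matrix (ι × μ) (ι × μ) ℂ := basisMatrix b ⊗ₖ (1 : Matrix μ μ ℂ) with hH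
  have hHm : H ∈ unitary (Matrix (ι × μ) (ι × μ) ℂ) := kronecker_one_mem_unitary (basisMatrix_mem b)
  set Z : ι → Matrix μ μ ℂ := fun k => weightedPartialTrace (ketBra (b k)) A with hZ
  set x : ι → ℝ := fun k => schattenNorm q (Z k) with hx
  have hx0 : ∀ k, 0 ≤ x k := fun k => schattenNorm_nonneg _ _
  set D : Matrix ι ι ℂ := ∑ k, (x k : ℂ) • ketBra (b k) with hD
  set N := (mapNorm q p L).toReal with hN
  have hN0 : 0 ≤ N := ENNReal.toReal_nonneg
  -- In the basis b, the Z k are the diagonal blocks of A and D has the eigenvalues ‖Z k‖_q, so this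
  -- is block pinching.
  have hDA : schattenNorm q D ≤ schattenNorm q A := by
    refine schattenNorm_le_of_rpow_le hq (schattenNorm_nonneg _ _) ?_
    rw [hD, schattenNorm_sum_smul_ketBra_rpow hq b hx0,
      ← schattenNorm_unitary_mul_mul (Unitary.star_mem hHm) hHm q A]
    refine le_trans (le_of_eq ?_) (sum_schattenNorm_blockAt_rpow_le hq _)
    refine Finset.sum_congr rfl fun k _ => ?_
    simp only [hx, hZ, weightedPartialTrace_ketBra, hH]
  have hΦD : Φ D = ∑ k, (x k : ℂ) • R k := by
    simp only [hΦ, measurePrepare, LinearMap.coe_mk, AddHom.coe_mk]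
    refine Finset.sum_congr rfl fun k _ => ?_
    rw [hD, sum_smul_ketBra, ketBra_eq b k, trace_unitary_diagonal_mul (basisMatrix_mem b)]
    congr 2
    simp [Pi.single_apply]
  have h1 : schattenNorm p (tensorMap Φ L A) ≤ N * schattenNorm p (Φ D) := by
    rw [hΦ, tensorMap_measurePrepare, ← hΦ, ← schattenNorm_smul hp hN0, hΦD, Finset.smul_sum]
    refine (schattenNorm_sum_kronecker_le_sum_smul hp hR (y := fun k => N * x k)
      fun k => schattenNorm_apply_le hq hp L (Z k)).trans (le_of_eq ?_)
    congr 1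
    refine Finset.sum_congr rfl fun k _ => ?_
    rw [smul_smul, Complex.ofReal_mul]
  calc _ ≤ N * schattenNorm p (Φ D) := h1
    _ ≤ N * ((mapNorm q p Φ).toReal * schattenNorm q A) :=
        mul_le_mul_of_nonneg_left ((schattenNorm_apply_le hq hp Φ D).trans
          (mul_le_mul_of_nonneg_left hDA ENNReal.toReal_nonneg)) hN0
    _ = _ := by ring

theorem trace_mul_nonneg_of_posSemidef {X B : Matrix ι ι ℂ} (hX : X.PosSemidef)
    (hB : B.PosSemidef) : 0 ≤ (X * B).trace := by
  obtain ⟨C, rfl⟩ := exists_eq_conjTranspose_mul_self hX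
  rw [Matrix.mul_assoc, trace_mul_comm]
  exact (hB.mul_mul_conjTranspose_same C).trace_nonneg

theorem sum_rpow_sub_one_mul_le {p : ℝ} (hp : 1 ≤ p) {x y : κ → ℝ} (hx : ∀ k, 0 ≤ x k)
    (hy : ∀ k, 0 ≤ y k) :
    ∑ k, x k ^ (p - 1) * y k ≤ (∑ k, x k ^ p) ^ (1 - 1 / p) * (∑ k, y k ^ p) ^ (1 / p) := by
  rcases hp.eq_or_lt with rfl | h1
  -- For p = 1 all zeroth powers are 1, including 0 ^ 0, so both sides equal ∑ y k.
  · simp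
  · have hp0 : 0 < p := by linarith
    have hconj : (p / (p - 1)).HolderConjugate p :=
      (Real.HolderConjugate.conjExponent h1).symm
    have h := Real.inner_le_Lp_mul_Lq_of_nonneg Finset.univ hconj
      (f := fun k => x k ^ (p - 1)) (g := y) (fun k _ => Real.rpow_nonneg (hx k) _)
      (fun k _ => hy k)
    have h2 : ∀ k, (x k ^ (p - 1)) ^ (p / (p - 1)) = x k ^ p := fun k => by
      rw [← Real.rpow_mul (hx k), mul_div_cancel₀ _ (by linarith)]
    have h3 : 1 / (p / (p - 1)) = 1 - 1 / p := by
      field_simp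
    simp_rw [h2, h3] at h
    exact h

theorem schattenNorm_tensorMap_le_of_isQC {q p : ℝ} (hq : 1 ≤ q) (hp : 1 ≤ p)
    {Φ : Matrix ι ι ℂ →ₗ[ℂ] Matrix κ κ ℂ} (hΦ : IsQC Φ)
    (L : Matrix μ μ ℂ →ₗ[ℂ] Matrix ν ν ℂ) (A : Matrix (ι × μ) (ι × μ) ℂ) :
    schattenNorm p (tensorMap Φ L A) ≤
      (mapNorm q p Φ).toReal * (mapNorm q p L).toReal * schattenNorm q A := by
  have hp0 : 0 < p := by linarith
  obtain ⟨X, b, hX, rfl⟩ := hΦ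
  set Φ := measurePrepare X (fun k => ketBra (b k)) with hΦ
  set N := (mapNorm q p L).toReal with hN
  have hN0 : 0 ≤ N := ENNReal.toReal_nonneg
  set P := (mapNorm q p Φ).toReal with hP
  have hP0 : 0 ≤ P := ENNReal.toReal_nonneg
  set Z : κ → Matrix μ μ ℂ := fun k => weightedPartialTrace (X k) A with hZ
  set x : κ → ℝ := fun k => schattenNorm q (Z k) with hx
  have hx0 : ∀ k, 0 ≤ x k := fun k => schattenNorm_nonneg _ _
  have hxp : ∀ k, 0 ≤ x k ^ (p - 1) := fun k => Real.rpow_nonneg (hx0 k) _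
  set S := ∑ k, x k ^ p with hS
  have hS0 : 0 ≤ S := Finset.sum_nonneg fun k _ => Real.rpow_nonneg (hx0 k) _
  have hA0 := schattenNorm_nonneg q A
  -- The weights x^{p-1} are those of equality in Hölder's inequality: pairing with x gives S, while
  -- pairing with the diagonal of Φ(B) costs only S^{1-1/p}.
  have hbound : S ≤ P * S ^ (1 - 1 / p) * schattenNorm q A := by
    choose Y hY hYx using fun k => exists_trace_mul_eq_schattenNorm hq (Z k)
    have h := norm_trace_sum_kronecker_mul_le_mul_schattenNorm hq
      (R := fun k => ((x k ^ (p - 1) : ℝ) : ℂ) • X k) (M := P * S ^ (1 - 1 / p)) (Y := Y)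
      (fun k => (hX k).smul (Complex.zero_le_real.mpr (hxp k)))
      (mul_nonneg hP0 (Real.rpow_nonneg hS0 _))
      (fun B hB => by
        have ht : ∀ k, (X k * B).trace = (((X k * B).trace.re : ℝ) : ℂ) ∧
            0 ≤ (X k * B).trace.re := fun k => by
          have h0 := Complex.nonneg_iff.mp (trace_mul_nonneg_of_posSemidef (hX k) hB)
          exact ⟨Complex.ext rfl h0.2.symm, h0.1⟩
        have hΦB : schattenNorm p (Φ B) = (∑ k, (X k * B).trace.re ^ p) ^ (1 / p) := by
          have h2 : Φ B = ∑ k, (((X k * B).trace.re : ℝ) : ℂ) • ketBra (b k) :=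
            Finset.sum_congr rfl fun k _ => by rw [← (ht k).1]
          rw [h2, ← schattenNorm_sum_smul_ketBra_rpow hp b fun k => (ht k).2,
            ← Real.rpow_mul (schattenNorm_nonneg _ _), mul_one_div_cancel hp0.ne', Real.rpow_one]
        have h3 : ((∑ k, ((x k ^ (p - 1) : ℝ) : ℂ) • X k) * B).trace.re =
            ∑ k, x k ^ (p - 1) * (X k * B).trace.re := by
          rw [Finset.sum_mul, trace_sum, Complex.re_sum]
          refine Finset.sum_congr rfl fun k _ => ?_
          rw [Matrix.smul_mul, trace_smul, smul_eq_mul, Complex.re_ofReal_mul]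
        rw [h3]
        refine (sum_rpow_sub_one_mul_le hp hx0 fun k => (ht k).2).trans ?_
        rw [← hΦB, mul_comm P, mul_assoc]
        exact mul_le_mul_of_nonneg_left (schattenNorm_apply_le hq hp Φ B)
          (Real.rpow_nonneg hS0 _))
      hY A
    have h4 : ((∑ k, (((x k ^ (p - 1) : ℝ) : ℂ) • X k) ⊗ₖ Y k) * A).trace = (S : ℂ) := by
      rw [Finset.sum_mul, trace_sum, hS, Complex.ofReal_sum]
      refine Finset.sum_congr rfl fun k _ => ?_
      rw [smul_kronecker, Matrix.smul_mul, trace_smul, trace_kronecker_mul, hYx k, smul_eq_mul,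
        ← Complex.ofReal_mul]
      congr 1
      change x k ^ (p - 1) * x k = x k ^ p
      rcases (hx0 k).eq_or_lt with h0 | h0
      · rw [← h0, mul_zero, Real.zero_rpow hp0.ne']
      · rw [Real.rpow_sub_one h0.ne', div_mul_cancel₀ _ h0.ne']
    rwa [h4, Complex.norm_real, Real.norm_of_nonneg hS0] at h
  have hSp : S ^ (1 / p) ≤ P * schattenNorm q A := by
    rcases hS0.eq_or_lt with h0 | h0
    · rw [← h0, Real.zero_rpow (by positivity)]
      positivity
    · have h5 : S ^ (1 / p) * S ^ (1 - 1 / p) = S := by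
        rw [← Real.rpow_add h0]
        simp
      refine le_of_mul_le_mul_right ?_ (Real.rpow_pos_of_pos h0 (1 - 1 / p))
      rw [h5]
      exact hbound.trans (le_of_eq (by ring))
  have hT : schattenNorm p (tensorMap Φ L A) ≤ N * S ^ (1 / p) := by
    have hHm : basisMatrix b ⊗ₖ (1 : Matrix ν ν ℂ) ∈ unitary (Matrix (κ × ν) (κ × ν) ℂ) :=
      kronecker_one_mem_unitary (basisMatrix_mem b)
    rw [hΦ, tensorMap_measurePrepare, sum_ketBra_kronecker,
      schattenNorm_unitary_mul_mul hHm (Unitary.star_mem hHm)]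
    refine schattenNorm_le_of_rpow_le hp (mul_nonneg hN0 (Real.rpow_nonneg hS0 _)) ?_
    rw [schattenNorm_diagBlocks_rpow hp, Real.mul_rpow hN0 (Real.rpow_nonneg hS0 _),
      ← Real.rpow_mul hS0, one_div_mul_cancel hp0.ne', Real.rpow_one, hS, Finset.mul_sum]
    refine Finset.sum_le_sum fun k _ => ?_
    rw [← Real.mul_rpow hN0 (hx0 k)]
    exact Real.rpow_le_rpow (schattenNorm_nonneg _ _) (schattenNorm_apply_le hq hp L (Z k)) hp0.le
  calc _ ≤ N * S ^ (1 / p) := hT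
    _ ≤ N * (P * schattenNorm q A) := mul_le_mul_of_nonneg_left hSp hN0
    _ = _ := by ring

theorem mapNorm_tensorMap_eq_mul {q p : ℝ} (hq : 1 ≤ q) (hp : 1 ≤ p)
    {Φ : Matrix ι ι ℂ →ₗ[ℂ] Matrix κ κ ℂ} (hΦ : IsCQ Φ ∨ IsQC Φ)
    (L : Matrix μ μ ℂ →ₗ[ℂ] Matrix ν ν ℂ) :
    mapNorm q p (tensorMap Φ L) = mapNorm q p Φ * mapNorm q p L := by
  refine le_antisymm ?_ (mapNorm_mul_le_mapNorm_tensorMap hq Φ L)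
  rw [← ENNReal.ofReal_toReal (mapNorm_ne_top hq hp Φ),
    ← ENNReal.ofReal_toReal (mapNorm_ne_top hq hp L), ← ENNReal.ofReal_mul ENNReal.toReal_nonneg]
  exact mapNorm_le_ofReal hq fun A => hΦ.elim
    (fun h => schattenNorm_tensorMap_le_of_isCQ hq hp h L A)
    (fun h => schattenNorm_tensorMap_le_of_isQC hq hp h L A)

theorem tensorMap_id (n : ℕ) :
    tensorMap (LinearMap.id : Matrix (Fin n) (Fin n) ℂ →ₗ[ℂ] Matrix (Fin n) (Fin n) ℂ)
      (LinearMap.id : Matrix μ μ ℂ →ₗ[ℂ] Matrix μ μ ℂ) = LinearMap.id := by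
  refine LinearMap.ext fun A => ?_
  simp only [tensorMap, LinearMap.coe_mk, AddHom.coe_mk, LinearMap.id_apply,
    single_kronecker_single, smul_single, smul_eq_mul, mul_one]
  conv_rhs => rw [Matrix.matrix_eq_sum_single A]
  simp only [Fintype.sum_prod_type]
  refine Finset.sum_congr rfl fun i _ => ?_
  rw [Finset.sum_comm]

theorem isCP_id : IsCP (LinearMap.id : Matrix μ μ ℂ →ₗ[ℂ] Matrix μ μ ℂ) := by
  intro n A hA
  rwa [tensorMap_id]

theorem potPurity_eq_mapNorm {q p : ℝ} (hq : 1 ≤ q) (hp : 1 ≤ p)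
    {Φ : Matrix ι ι ℂ →ₗ[ℂ] Matrix κ κ ℂ} (hΦ : IsCQ Φ ∨ IsQC Φ) :
    potPurity q p Φ = mapNorm q p Φ := by
  have key : ∀ (n : ℕ) (Ω : Matrix (Fin n) (Fin n) ℂ →ₗ[ℂ] Matrix (Fin n) (Fin n) ℂ), Ω ≠ 0 →
      mapNorm q p (tensorMap Φ Ω) / mapNorm q p Ω = mapNorm q p Φ := fun n Ω hΩ => by
    rw [mapNorm_tensorMap_eq_mul hq hp hΦ,
      ENNReal.mul_div_cancel_right (mapNorm_ne_zero hq hp hΩ) (mapNorm_ne_top hq hp Ω)]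
  refine le_antisymm ?_ ?_
  · exact iSup₂_le fun n _ => iSup₂_le fun Ω _ => iSup_le fun hΩ => (key n Ω hΩ).le
  -- All admissible quotients have the same value, so one nonzero completely positive map suffices
  -- for the lower bound.
  · have hid : (LinearMap.id : Matrix (Fin 1) (Fin 1) ℂ →ₗ[ℂ] Matrix (Fin 1) (Fin 1) ℂ) ≠ 0 :=
      fun h => one_ne_zero (LinearMap.congr_fun h (1 : Matrix (Fin 1) (Fin 1) ℂ))
    rw [← key 1 LinearMap.id hid]
    exact le_iSup₂_of_le 1 le_rfl (le_iSup₂_of_le LinearMap.id isCP_id (le_iSup_of_le hid le_rfl))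

end Multiplicativity

end

theorem theorem3 (d d' : ℕ) (Φ : Matrix (Fin d) (Fin d) ℂ →ₗ[ℂ] Matrix (Fin d') (Fin d') ℂ)
    (hΦ : IsCQ Φ ∨ IsQC Φ) (q p : ℝ) (hq : 1 ≤ q) (hp : 1 ≤ p) :
    potPurity q p Φ = mapNorm q p Φ ∧
      ∀ (n n' : ℕ) (Ω : Matrix (Fin n) (Fin n) ℂ →ₗ[ℂ] Matrix (Fin n') (Fin n') ℂ), IsCP Ω →
        mapNorm q p (tensorMap Φ Ω) = mapNorm q p Φ * mapNorm q p Ω :=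
  ⟨potPurity_eq_mapNorm hq hp hΦ, fun _ _ Ω _ => mapNorm_tensorMap_eq_mul hq hp hΦ Ω⟩
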